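/- All tournaments are finite. A set of vertices of a tournament is called independent if it induces a transitive subtournament, and a tournament $G$ is $H$-free if it has no induced subgraph isomorphic to the tournament $H$. The problem WMISP is: given a tournament $G$ and a weight function $w:V(G)\to\mathbb{Q}_{\ge 0}$, find the maximum weight $\sum_{v\in S}w(v)$ of an independent set $S$ of $G$. Instances are encoded by the adjacency matrix of $G$ and the weights, written as fractions in binary, and the answer is output as a fraction in binary. Theorem. For every tournament $H$ with $4$ vertices, WMISP restricted to $H$-free tournaments can be solved by a Turing machine in time polynomial in the length of the input. Moreover, let $K_4$ be the transitive tournament on $4$ vertices, let $B_4$ be the tournament on $4$ vertices consisting of a cyclic triangle and a vertex with an arc to each of its three vertices, and let $C_4$ be the strongly connected tournament on $4$ vertices. Then: 1. up to isomorphism there are only finitely many $K_4$-free tournaments; 2. for every non-empty $B_4$-free tournament $G$ and every $w:V(G)\to\mathbb{Q}_{\ge 0}$ there is a vertex $v$ whose closed out-neighbourhood $\{v\}\cup N^+(v)$ is an independent set of maximum weight; 3. every strong component of a $C_4$-free tournament has exactly $1$ or $3$ vertices. -/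

import Mathlib

/-- A tournament on the vertex set `V`: a loopless directed graph with exactly one arc between any
two distinct vertices. `G.Adj u v` means that the arc goes from `u` to `v`. -/
structure Tournament (V : Type*) extends Digraph V where
  loopless : ∀ v, ¬ Adj v v
  exactly_one : ∀ u v, u ≠ v → (Adj u v ↔ ¬ Adj v u)

namespace Tournament

/-- `G` is `H`-free: no induced subgraph of `G` is isomorphic to `H`. An induced copy of `H` in `G`
is an injective map of the vertices that preserves and reflects arcs. -/
def IsFree {V W : Type*} (G : Tournament V) (H : Tournament W) : Prop :=
  IsEmpty (H.Adj ↪r G.Adj)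

/-- A set of vertices of a tournament is independent if it induces a transitive tournament. -/
def IsIndep {V : Type*} (G : Tournament V) (S : Set V) : Prop :=
  ∀ u ∈ S, ∀ v ∈ S, ∀ w ∈ S, G.Adj u v → G.Adj v w → G.Adj u w

/-- The closed out-neighbourhood of `v`. -/
noncomputable def closedOut {V : Type*} [Fintype V] (G : Tournament V) (v : V) : Finset V :=
  open Classical in {u : V | u = v ∨ G.Adj v u}

/-- The strong component of `v`: all vertices `u` with a directed walk from `v` to `u` and a
directed walk from `u` to `v`. -/
def strongComponent {V : Type*} (G : Tournament V) (v : V) : Set V :=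
  {u | Relation.ReflTransGen G.Adj v u ∧ Relation.ReflTransGen G.Adj u v}

/-- The transitive tournament on four vertices. -/
def K4 : Tournament (Fin 4) where
  Adj i j := i < j
  loopless := by decide
  exactly_one := by decide

/-- The tournament on four vertices in which `3` is a source and `0 → 1 → 2 → 0` is a cyclic
triangle. -/
def B4 : Tournament (Fin 4) where
  Adj i j := (i, j) ∈ ([(0, 1), (2, 0), (3, 0), (1, 2), (3, 1), (3, 2)] : List (Fin 4 × Fin 4))
  loopless := by decide
  exactly_one := by decide

/-- The strongly connected tournament on four vertices. -/
def C4 : Tournament (Fin 4) where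
  Adj i j := (i, j) ∈ ([(0, 1), (2, 0), (0, 3), (1, 2), (3, 1), (2, 3)] : List (Fin 4 × Fin 4))
  loopless := by decide
  exactly_one := by decide

end Tournament

namespace WMISP

/-- A nonnegative rational number, written as a fraction with positive denominator (not
necessarily in lowest terms). -/
abbrev Fraction : Type := ℕ × ℕ+

/-- The rational number that a fraction denotes. -/
def Fraction.value (q : Fraction) : ℚ := (q.1 : ℚ) / ((q.2 : ℕ) : ℚ)

/-- The tape alphabet: the bits `some false`, `some true` and the separator `none`. -/
abbrev Symbol : Type := Option Bool

/-- A natural number in binary, least significant bit first. -/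
def encodeNat (k : ℕ) : List Symbol := (Computability.encodeNat k).map some

/-- A fraction: numerator and denominator in binary, each followed by a separator. -/
def Fraction.encode (q : Fraction) : List Symbol :=
  encodeNat q.1 ++ [none] ++ encodeNat (q.2 : ℕ) ++ [none]

/-- An instance of the weighted maximum independent set problem: a tournament with vertices
`0, …, n - 1` and a nonnegative rational weight for each vertex. -/
structure Instance where
  n : ℕ
  G : Tournament (Fin n)
  w : Fin n → Fraction

/-- The input string of an instance: for each vertex in turn, its row of the adjacency matrix
followed by its weight. -/
noncomputable def Instance.encode (I : Instance) : List Symbol :=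
  open Classical in
  (List.finRange I.n).flatMap fun v =>
    ((List.finRange I.n).map fun u => some (decide (I.G.Adj v u))) ++ (I.w v).encode

/-- `q` is the maximum weight of an independent set of the instance. -/
def Instance.IsMaxWeight (I : Instance) (q : ℚ) : Prop :=
  IsGreatest {x : ℚ | ∃ S : Finset (Fin I.n), I.G.IsIndep (S : Set (Fin I.n)) ∧
    x = ∑ v ∈ S, (I.w v).value} q

/-- The problem restricted to the instances in the class `C` is solvable in polynomial time: some
Turing machine, started on the input string of an instance in `C`, halts with the maximum weight of
an independent set written on its output tape as a fraction, after a number of steps that is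
bounded by a polynomial in the length of the input string. -/
def SolvableInPolyTime (C : Instance → Prop) : Prop :=
  ∃ f : {I : Instance // C I} → Fraction,
    (∀ I : {I : Instance // C I}, I.1.IsMaxWeight (f I).value) ∧
    Nonempty (Turing.TM2ComputableInPolyTime
      (fun I : {I : Instance // C I} => I.1.encode) Fraction.encode f)

end WMISP

/-! Combinatorics. A set of vertices is independent exactly when it contains no cyclic triangle
(`isIndep_iff`). Every tournament on 4 vertices is `K4`, `B4`, the reverse of `B4`, or `C4`
(`exists_hom_of_card_eq_four`), and excluding any of them leaves few candidates for an optimum.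
Without `K4`, passing repeatedly to out- or in-neighbourhoods shows that there are fewer than 8
vertices, and independent sets have at most 3. Without `B4`, closed out-neighbourhoods are
independent; a nonempty independent set has a source, whose closed out-neighbourhood contains it and
weighs at least as much. Reversing all arcs settles the reverse of `B4`. Without `C4`, a vertex
outside a cyclic triangle dominates all of it or is dominated by all of it. Hence cyclic triangles
are disjoint and are strong components, every other vertex is a strong component by itself, and
deleting the lightest vertex of each triangle gives an optimum by an exchange argument
(`sum_le_notLeast`).

Algorithm. One algorithm, `solve`, serves every tournament on 4 vertices: it maximises over all four
kinds of candidates, and a candidate that is not independent scores 0. The result is therefore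
always the weight of an independent set, and in each of the four cases one kind of candidate attains
the maximum.

Complexity. Flow charts over four stacks compile to stack machines (`toFinTM2`). Data are binary
trees in prefix code, so the end of a tree is recognisable without markers. The class `PolyTime` of
functions on such data is closed under composition, pairing, case distinction and folds whose
accumulator stays polynomially small (`PolyTime.foldl`). Binary arithmetic, parsing and the search
are written with these operations, so their running times need no separate analysis beyond bounds on
the sizes of accumulators. -/

/-!
## Structured programs on four stacks
-/

namespace StackMachine

open WMISP (Symbol)

/-- The stacks of the machine. -/
inductive Reg
  | main | aux | tmp | ctr
  deriving DecidableEq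

instance : Fintype Reg := ⟨{.main, .aux, .tmp, .ctr}, by intro x; cases x <;> decide⟩

/-- The contents of all stacks. -/
abbrev Store : Type := Reg → List Symbol

/-- An instruction pushes a constant, or pops a symbol and jumps depending on it. -/
inductive Instr (L : Type)
  | push (k : Reg) (a : Symbol) (l : L)
  | pop (k : Reg) (f : Option Symbol → L)

namespace Instr

variable {L M : Type}

def map (e : L → M) : Instr L → Instr M
  | push k a l => push k a (e l)
  | pop k f => pop k (e ∘ f)

/-- The next label and the resulting store. -/
def exec : Instr L → Store → L × Store
  | push k a l, s => (l, Function.update s k (a :: s k))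
  | pop k f, s => (f (s k).head?, Function.update s k (s k).tail)

/-- The statement of a stack machine with one register that corresponds to an instruction. -/
def toStmt : Instr L → Turing.TM2.Stmt (fun _ : Reg => Symbol) L (Option Symbol)
  | push k a l => .push k (fun _ => a) (.goto fun _ => l)
  | pop k f => .pop k (fun _ x => x) (.goto f)

theorem exec_map (e : L → M) (i : Instr L) (s : Store) :
    (i.map e).exec s = (e (i.exec s).1, (i.exec s).2) := by
  cases i <;> rfl

end Instr

/-- A program fragment with one entry and one exit; the exit is the label `none`. -/
structure Frag where
  Lab : Type
  [fin : Fintype Lab]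
  entry : Option Lab
  code : Lab → Instr (Option Lab)

attribute [instance] Frag.fin

/-- `Steps code n c c'`: the configuration `c'` is reached from `c` in exactly `n` steps. -/
inductive Steps {Λ : Type} (code : Λ → Instr (Option Λ)) :
    ℕ → Option Λ × Store → Option Λ × Store → Prop
  | refl (c) : Steps code 0 c c
  | head {n l s c} : Steps code n ((code l).exec s) c → Steps code (n + 1) (some l, s) c

namespace Steps

variable {Λ Λ' : Type} {code : Λ → Instr (Option Λ)} {code' : Λ' → Instr (Option Λ')}

theorem trans {m n : ℕ} {c c' c'' : Option Λ × Store} (h : Steps code m c c')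
    (h' : Steps code n c' c'') : Steps code (m + n) c c'' := by
  induction h with
  | refl => simpa using h'
  | head _ ih => rw [Nat.add_right_comm]; exact .head (ih h')

/-- Only proper labels are constrained, so `e` may send the exit `none` to any label of the larger
program. Sequencing and looping are both obtained by such a redirection of the exit. -/
theorem embed (e : Option Λ → Option Λ')
    (he : ∀ l, ∃ l', e (some l) = some l' ∧ code' l' = (code l).map e)
    {n : ℕ} {c c' : Option Λ × Store} (h : Steps code n c c') :
    Steps code' n (e c.1, c.2) (e c'.1, c'.2) := by
  induction h with
  | refl => exact .refl _
  | @head n l s c _ ih =>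
    obtain ⟨l', h₁, h₂⟩ := he l
    simp only [h₁]
    refine .head ?_
    rw [h₂, Instr.exec_map]
    exact ih

/-- One step pushes at most one symbol. Consequently a time bound is also a bound on the size of the
output. -/
theorem length_le (k : Reg) {n : ℕ} {c c' : Option Λ × Store} (h : Steps code n c c') :
    (c'.2 k).length ≤ (c.2 k).length + n := by
  induction h with
  | refl => simp
  | @head n l s c _ ih =>
    refine ih.trans ?_
    cases hl : code l with
    | push k' a l' =>
      by_cases hk : k = k'
      · subst hk; simp [Instr.exec]; omega
      · simp [Instr.exec, hk]
    | pop k' f =>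
      by_cases hk : k = k'
      · subst hk; simp [Instr.exec]; omega
      · simp [Instr.exec, hk]

end Steps

namespace Frag

/-- `F.Runs s s' t`: started with the store `s`, the fragment `F` reaches its exit with the store
`s'` in at most `t` steps. -/
def Runs (F : Frag) (s s' : Store) (t : ℕ) : Prop :=
  ∃ n ≤ t, Steps F.code n (F.entry, s) (none, s')

theorem Runs.mono {F : Frag} {s s' : Store} {t t' : ℕ} (h : F.Runs s s' t) (ht : t ≤ t') :
    F.Runs s s' t' :=
  let ⟨n, hn, h⟩ := h
  ⟨n, hn.trans ht, h⟩

theorem Runs.length_le {F : Frag} {s s' : Store} {t : ℕ} (h : F.Runs s s' t) (k : Reg) :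
    (s' k).length ≤ (s k).length + t :=
  let ⟨_, hn, h⟩ := h
  (h.length_le k).trans (Nat.add_le_add_left hn _)

/-- The entry is already the exit, so no step is spent; this is why the entry of a fragment is an
option. -/
def skip : Frag where
  Lab := Empty
  entry := none
  code := Empty.elim

theorem runs_skip (s : Store) : skip.Runs s s 0 := ⟨0, le_rfl, .refl _⟩

def push (k : Reg) (a : Symbol) : Frag where
  Lab := Unit
  entry := some ()
  code _ := .push k a none

theorem runs_push (k : Reg) (a : Symbol) (s : Store) :
    (push k a).Runs s (Function.update s k (a :: s k)) 1 :=
  ⟨1, le_rfl, .head (.refl _)⟩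

def seq (F G : Frag) : Frag where
  Lab := F.Lab ⊕ G.Lab
  entry := F.entry.elim (G.entry.map .inr) (fun l => some (.inl l))
  code
    | .inl l => (F.code l).map fun x => x.elim (G.entry.map .inr) (fun l => some (.inl l))
    | .inr l => (G.code l).map (Option.map .inr)

theorem Runs.seq {F G : Frag} {s s' s'' : Store} {t t' : ℕ} (h : F.Runs s s' t)
    (h' : G.Runs s' s'' t') : (F.seq G).Runs s s'' (t + t') := by
  obtain ⟨n, hn, h⟩ := h
  obtain ⟨n', hn', h'⟩ := h'
  refine ⟨n + n', by omega, ?_⟩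
  refine Steps.trans (h.embed (code' := (F.seq G).code)
    (fun x => x.elim (G.entry.map .inr) (fun l => some (.inl l))) ?_)
    (h'.embed (code' := (F.seq G).code) (Option.map .inr) ?_)
  · exact fun l => ⟨_, rfl, rfl⟩
  · exact fun l => ⟨_, rfl, rfl⟩

/-- Pop a symbol from `k` and run the corresponding fragment; then start again if `back` says so. -/
def branch (k : Reg) (F : Option Symbol → Frag) (back : Option Symbol → Bool) : Frag where
  Lab := Option (Σ x, (F x).Lab)
  entry := some none
  code
    | none => .pop k fun x => (F x).entry.elim (bif back x then some none else none)
        (fun l => some (some ⟨x, l⟩))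
    | some ⟨x, l⟩ => ((F x).code l).map fun y => y.elim (bif back x then some none else none)
        (fun l => some (some ⟨x, l⟩))

theorem Runs.branch_aux {k : Reg} {F : Option Symbol → Frag} {back : Option Symbol → Bool}
    {s s' : Store} {t : ℕ}
    (h : (F (s k).head?).Runs (Function.update s k (s k).tail) s' t) :
    ∃ n ≤ t + 1, Steps (branch k F back).code n (some none, s)
      (bif back (s k).head? then some none else none, s') := by
  obtain ⟨n, hn, h⟩ := h
  refine ⟨n + 1, by omega, .head ?_⟩
  exact h.embed (code' := (Frag.branch k F back).code)
    (fun y => y.elim (bif back (s k).head? then some none else none)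
      (fun l => some (some ⟨(s k).head?, l⟩))) (fun l => ⟨_, rfl, rfl⟩)

theorem Runs.branch_exit {k : Reg} {F : Option Symbol → Frag} {back : Option Symbol → Bool}
    {s s' : Store} {t : ℕ} (hb : back (s k).head? = false)
    (h : (F (s k).head?).Runs (Function.update s k (s k).tail) s' t) :
    (branch k F back).Runs s s' (t + 1) := by
  obtain ⟨n, hn, h⟩ := Runs.branch_aux (back := back) h
  rw [hb] at h
  exact ⟨n, hn, h⟩

theorem Runs.branch_back {k : Reg} {F : Option Symbol → Frag} {back : Option Symbol → Bool}
    {s s' s'' : Store} {t t' : ℕ} (hb : back (s k).head? = true)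
    (h : (F (s k).head?).Runs (Function.update s k (s k).tail) s' t)
    (h' : (branch k F back).Runs s' s'' t') :
    (branch k F back).Runs s s'' (t + 1 + t') := by
  obtain ⟨n, hn, h⟩ := Runs.branch_aux (back := back) h
  obtain ⟨n', hn', h'⟩ := h'
  rw [hb] at h
  exact ⟨n + n', by omega, h.trans h'⟩

/-- The Turing machine that runs a fragment; input and output are on the main stack. -/
def toFinTM2 (F : Frag) : Turing.FinTM2 where
  K := Reg
  k₀ := .main
  k₁ := .main
  Γ _ := Symbol
  Λ := Option F.Lab
  main := F.entry
  σ := Option Symbol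
  initialState := none
  m
    -- The prescribed final configuration has the initial register content, so the register is
    -- cleared before halting.
    | none => .load (fun _ => none) .halt
    | some l => (F.code l).toStmt

theorem iterate_toFinTM2 (F : Frag) {n : ℕ} {c c' : Option F.Lab × Store}
    (h : Steps F.code n c c') (v : Option Symbol) : ∃ v',
      (flip bind F.toFinTM2.step)^[n] (some ⟨some c.1, v, c.2⟩) = some ⟨some c'.1, v', c'.2⟩ := by
  induction h generalizing v with
  | refl => exact ⟨v, rfl⟩
  | @head n l s c _ ih =>
    simp only [Function.iterate_succ_apply]
    have : ∃ w, flip bind F.toFinTM2.step (some ⟨some (some l), v, s⟩) =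
        some ⟨some ((F.code l).exec s).1, w, ((F.code l).exec s).2⟩ := by
      have : flip bind F.toFinTM2.step (some ⟨some (some l), v, s⟩) =
        some (Turing.TM2.stepAux (F.code l).toStmt v s) := rfl
      rw [this]
      cases F.code l with
      | push k a l' => exact ⟨v, rfl⟩
      | pop k f => exact ⟨(s k).head?, rfl⟩
    obtain ⟨w, hw⟩ := this
    rw [hw]
    exact ih w

/-- The store with given contents of the stacks. -/
def st (m a b c : List Symbol) : Store
  | .main => m
  | .aux => a
  | .tmp => b
  | .ctr => c

/-- The store with given contents of the main stack and the other stacks empty. -/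
abbrev onMain (l : List Symbol) : Store := st l [] [] []

/-- A fragment that maps input strings to output strings in polynomial time gives a Turing machine
that does so. -/
noncomputable def computableInPolyTime {α β : Type} {ea : α → List Symbol} {eb : β → List Symbol}
    {f : α → β} (F : Frag) (p : Polynomial ℕ)
    (h : ∀ a, F.Runs (onMain (ea a)) (onMain (eb (f a))) (p.eval (ea a).length)) :
    Turing.TM2ComputableInPolyTime ea eb f where
  tm := F.toFinTM2
  inputAlphabet := Equiv.refl _
  outputAlphabet := Equiv.refl _
  -- The additional step executes the halting statement at the exit label.
  time := p + 1
  outputsFun a :=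
    { steps := (h a).choose + 1
      evals_in_steps := by
        obtain ⟨hn, hs⟩ := (h a).choose_spec
        obtain ⟨v, hv⟩ := F.iterate_toFinTM2 hs none
        rw [Function.iterate_succ_apply']
        have h₁ : Turing.initList F.toFinTM2 (List.map (Equiv.refl Symbol).invFun (ea a)) =
            ⟨some F.entry, none, onMain (ea a)⟩ := by
          simp only [Turing.initList]
          congr 1
          funext k
          cases k
          · exact List.map_id _
          all_goals rfl
        have h₂ : Turing.haltList F.toFinTM2 (List.map (Equiv.refl Symbol).invFun (eb (f a))) =
            ⟨none, none, onMain (eb (f a))⟩ := by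
          simp only [Turing.haltList]
          congr 1
          funext k
          cases k
          · exact List.map_id _
          all_goals rfl
        refine (congrArg (flip bind F.toFinTM2.step)
          ((congrArg (fun c => (flip bind F.toFinTM2.step)^[(h a).choose] (some c)) h₁).trans
            hv)).trans ?_
        refine Eq.trans ?_ (congrArg some h₂).symm
        rfl
      steps_le_m := by
        have := (h a).choose_spec.1
        simpa using this }

end Frag

end StackMachine

/-!
## Trees on the main stack
-/

namespace StackMachine

open WMISP (Symbol)

namespace Frag

section Update

variable (m a b c l : List Symbol)

@[simp] theorem st_main : st m a b c .main = m := rfl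
@[simp] theorem st_aux : st m a b c .aux = a := rfl
@[simp] theorem st_tmp : st m a b c .tmp = b := rfl
@[simp] theorem st_ctr : st m a b c .ctr = c := rfl

@[simp] theorem update_main : Function.update (st m a b c) .main l = st l a b c := by
  funext k; cases k <;> simp

@[simp] theorem update_aux : Function.update (st m a b c) .aux l = st m l b c := by
  funext k; cases k <;> simp

@[simp] theorem update_tmp : Function.update (st m a b c) .tmp l = st m a l c := by
  funext k; cases k <;> simp

@[simp] theorem update_ctr : Function.update (st m a b c) .ctr l = st m a b l := by
  funext k; cases k <;> simp

end Update

theorem runs_push_main (x : Symbol) (m a b c : List Symbol) :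
    (push .main x).Runs (st m a b c) (st (x :: m) a b c) 1 := by
  simpa using runs_push .main x (st m a b c)

theorem runs_push_aux (x : Symbol) (m a b c : List Symbol) :
    (push .aux x).Runs (st m a b c) (st m (x :: a) b c) 1 := by
  simpa using runs_push .aux x (st m a b c)

theorem runs_push_tmp (x : Symbol) (m a b c : List Symbol) :
    (push .tmp x).Runs (st m a b c) (st m a (x :: b) c) 1 := by
  simpa using runs_push .tmp x (st m a b c)

theorem runs_push_ctr (x : Symbol) (m a b c : List Symbol) :
    (push .ctr x).Runs (st m a b c) (st m a b (x :: c)) 1 := by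
  simpa using runs_push .ctr x (st m a b c)

/-- Pop all symbols of `k`, running `F x` for each symbol `x`. -/
def forEach (k : Reg) (F : Symbol → Frag) : Frag :=
  branch k (fun x => x.elim skip F) Option.isSome

theorem runs_forEach_nil {k : Reg} {F : Symbol → Frag} {s : Store} (h : s k = []) :
    (forEach k F).Runs s s 1 := by
  refine Runs.branch_exit (by simp [h]) (t := 0) ?_
  have : Function.update s k (s k).tail = s := by simp [h]
  rw [this, h]
  exact runs_skip s

theorem Runs.forEach_cons {k : Reg} {F : Symbol → Frag} {s s' s'' : Store} {x : Symbol}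
    {l : List Symbol} {t t' : ℕ} (h : s k = x :: l)
    (h₁ : (F x).Runs (Function.update s k l) s' t) (h₂ : (forEach k F).Runs s' s'' t') :
    (forEach k F).Runs s s'' (t + 1 + t') := by
  refine Runs.branch_back (by simp [h]) ?_ h₂
  simpa [h] using h₁

/-- Move the auxiliary stack to the main stack, reversing it. -/
abbrev auxToMain : Frag := forEach .aux (push .main)

theorem runs_auxToMain (m a b c : List Symbol) :
    auxToMain.Runs (st m a b c) (st (a.reverse ++ m) [] b c) (2 * a.length + 1) := by
  induction a generalizing m with
  | nil => exact runs_forEach_nil rfl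
  | cons x a ih =>
    have := Runs.forEach_cons (k := .aux) (F := push .main) (s := st m (x :: a) b c) rfl
      (by simpa using runs_push_main x m a b c) (ih (x :: m))
    simpa using this.mono (by simp; omega)

abbrev auxToTmp : Frag := forEach .aux (push .tmp)

theorem runs_auxToTmp (m a b c : List Symbol) :
    auxToTmp.Runs (st m a b c) (st m [] (a.reverse ++ b) c) (2 * a.length + 1) := by
  induction a generalizing b with
  | nil => exact runs_forEach_nil rfl
  | cons x a ih =>
    have := Runs.forEach_cons (k := .aux) (F := push .tmp) (s := st m (x :: a) b c) rfl
      (by simpa using runs_push_tmp x m a b c) (ih (x :: b))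
    simpa using this.mono (by simp; omega)

abbrev tmpToAux : Frag := forEach .tmp (push .aux)

theorem runs_tmpToAux (m a b c : List Symbol) :
    tmpToAux.Runs (st m a b c) (st m (b.reverse ++ a) [] c) (2 * b.length + 1) := by
  induction b generalizing a with
  | nil => exact runs_forEach_nil rfl
  | cons x b ih =>
    have := Runs.forEach_cons (k := .tmp) (F := push .aux) (s := st m a (x :: b) c) rfl
      (by simpa using runs_push_aux x m a b c) (ih (x :: a))
    simpa using this.mono (by simp; omega)

abbrev auxToMainTmp : Frag := forEach .aux fun x => (push .main x).seq (push .tmp x)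

theorem runs_auxToMainTmp (m a b c : List Symbol) :
    auxToMainTmp.Runs (st m a b c) (st (a.reverse ++ m) [] (a.reverse ++ b) c)
      (3 * a.length + 1) := by
  induction a generalizing m b with
  | nil => exact runs_forEach_nil rfl
  | cons x a ih =>
    have := Runs.forEach_cons (k := .aux) (F := fun x => (push .main x).seq (push .tmp x))
      (s := st m (x :: a) b c) rfl
      (by simpa using (runs_push_main x m a b c).seq (runs_push_tmp x (x :: m) a b c))
      (ih (x :: m) (x :: b))
    simpa using this.mono (by simp; omega)

abbrev clearAux : Frag := forEach .aux fun _ => skip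

theorem runs_clearAux (m a b c : List Symbol) :
    clearAux.Runs (st m a b c) (st m [] b c) (a.length + 1) := by
  induction a with
  | nil => exact runs_forEach_nil rfl
  | cons x a ih =>
    have := Runs.forEach_cons (k := .aux) (F := fun _ => skip)
      (s := st m (x :: a) b c) rfl (by simpa using runs_skip (st m a b c)) ih
    simpa using this.mono (by simp; omega)

end Frag

/-- Binary trees with a bit at each leaf. -/
inductive BTree
  | leaf (b : Bool)
  | node (l r : BTree)

/-- The prefix code of a tree. -/
def BTree.code : BTree → List Symbol
  | leaf b => [some b]
  | node l r => none :: (l.code ++ r.code)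

namespace Frag

/-- One step of `moveTrees`, for the symbol `x` on the main stack. -/
def moveSymbol : Option Symbol → Frag
  | none => skip
  | some (some b) => push .aux (some b)
  | some none => ((push .aux none).seq (push .ctr none)).seq (push .ctr none)

/-- Move as many trees to the auxiliary stack as there are symbols on the counter. -/
def moveTrees : Frag := forEach .ctr fun _ => branch .main moveSymbol fun _ => false

/-- The counter holds one symbol for each tree still to be read: a leaf uses up one, a node uses up
one and adds two. A node costs two pops and three pushes, whence the factor 5. The remaining run is
a hypothesis, so that the induction hypotheses for the two subtrees can be chained. -/
theorem runs_moveTrees (t : BTree) {m a b c : List Symbol} {x : Symbol} {s : Store} {n : ℕ}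
    (h : moveTrees.Runs (st m (t.code.reverse ++ a) b c) s n) :
    moveTrees.Runs (st (t.code ++ m) a b (x :: c)) s (5 * t.code.length + n) := by
  induction t generalizing m a c x n with
  | leaf y =>
    refine Runs.mono (t := 2 + 1 + n) ?_ (by simp [BTree.code])
    refine Runs.forEach_cons (l := c) rfl ?_ h
    refine Runs.branch_exit rfl (t := 1) ?_
    simpa [BTree.code, moveSymbol] using runs_push_aux (some y) m a b c
  | node l r ihl ihr =>
    refine Runs.mono (t := 4 + 1 + (5 * l.code.length + (5 * r.code.length + n))) ?_
      (by simp [BTree.code]; omega)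
    refine Runs.forEach_cons (l := c) (s' := st (l.code ++ (r.code ++ m)) (none :: a) b
      (none :: none :: c)) rfl ?_ (ihl (ihr ?_))
    · refine Runs.branch_exit rfl (t := 3) ?_
      simpa [BTree.code, moveSymbol] using ((runs_push_aux none (l.code ++ (r.code ++ m)) a b c).seq
        (runs_push_ctr none _ _ _ _)).seq (runs_push_ctr none _ _ _ _)
    · simpa [BTree.code] using h

/-- Move the top tree to the auxiliary stack, reversing its code. -/
def moveTree : Frag := (push .ctr none).seq moveTrees

theorem runs_moveTree (t : BTree) (m a b : List Symbol) :
    moveTree.Runs (st (t.code ++ m) a b []) (st m (t.code.reverse ++ a) b [])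
      (5 * t.code.length + 2) :=
  ((runs_push_ctr none _ _ _ _).seq (runs_moveTrees t (runs_forEach_nil rfl))).mono (by omega)

def drop : Frag := moveTree.seq clearAux

theorem runs_drop (t : BTree) (m : List Symbol) :
    drop.Runs (onMain (t.code ++ m)) (onMain m) (6 * t.code.length + 3) := by
  refine ((runs_moveTree t m [] []).seq (runs_clearAux _ _ _ _)).mono ?_
  simp; omega

def dup : Frag := ((moveTree.seq auxToMainTmp).seq tmpToAux).seq auxToMain

theorem runs_dup (t : BTree) (m : List Symbol) :
    dup.Runs (onMain (t.code ++ m)) (onMain (t.code ++ (t.code ++ m)))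
      (12 * t.code.length + 5) := by
  have := (((runs_moveTree t m [] []).seq (runs_auxToMainTmp _ _ _ _)).seq
    (runs_tmpToAux _ _ _ _)).seq (runs_auxToMain _ _ _ _)
  simp only [List.append_nil, List.reverse_reverse, List.length_reverse] at this
  exact this.mono (by omega)

/-- The first tree waits on `tmp` while the second is moved; it then lands above the second on
`aux`, and emptying `aux` exchanges the two. -/
def swap : Frag := (((moveTree.seq auxToTmp).seq moveTree).seq tmpToAux).seq auxToMain

theorem runs_swap (t u : BTree) (m : List Symbol) :
    swap.Runs (onMain (t.code ++ (u.code ++ m))) (onMain (u.code ++ (t.code ++ m)))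
      (11 * (t.code.length + u.code.length) + 7) := by
  have := ((((runs_moveTree t (u.code ++ m) [] []).seq (runs_auxToTmp _ _ _ _)).seq
    (runs_moveTree u _ _ _)).seq (runs_tmpToAux _ _ _ _)).seq (runs_auxToMain _ _ _ _)
  simp only [List.append_nil, List.reverse_reverse, List.reverse_append, List.append_assoc,
    List.length_append, List.length_reverse] at this
  exact this.mono (by omega)

/-- Pop a symbol from the main stack and continue according to it. -/
def case (F : Option Symbol → Frag) : Frag := branch .main F fun _ => false

theorem Runs.case {F : Option Symbol → Frag} {x : Symbol} {m : List Symbol} {s : Store} {t : ℕ}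
    (h : (F (some x)).Runs (onMain m) s t) :
    (Frag.case F).Runs (onMain (x :: m)) s (t + 1) :=
  Runs.branch_exit rfl (by simpa using h)

end Frag

end StackMachine

/-!
## Functions computable in polynomial time
-/

namespace StackMachine

open WMISP (Symbol)
open Frag

namespace Frag

/-- Selects a fragment according to the symbol for a node or a leaf. -/
def select (N F₁ F₀ : Frag) : Option Symbol → Frag
  | none => skip
  | some none => N
  | some (some b) => bif b then F₁ else F₀

def isNode : Option Symbol → Bool
  | some none => true
  | _ => false

end Frag

/-- Types whose elements are represented by trees. -/
class Enc (α : Type) where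
  tree : α → BTree

variable {α β γ σ : Type} [Enc α] [Enc β] [Enc γ] [Enc σ]

/-- The code of an element on a stack. -/
def code (a : α) : List Symbol := (Enc.tree a).code

def size (a : α) : ℕ := (code a).length

instance : Enc Bool := ⟨.leaf⟩

instance : Enc (α × β) := ⟨fun x => .node (Enc.tree x.1) (Enc.tree x.2)⟩

instance : Enc (List α) := ⟨fun l => l.foldr (fun a t => .node (Enc.tree a) t) (.leaf false)⟩

theorem code_pair (a : α) (b : β) : code (a, b) = none :: (code a ++ code b) := rfl

theorem code_nil : code ([] : List α) = [some false] := rfl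

theorem code_cons (a : α) (l : List α) : code (a :: l) = none :: (code a ++ code l) := rfl

@[simp] theorem size_bool (b : Bool) : size b = 1 := rfl

@[simp] theorem size_pair (a : α) (b : β) : size (a, b) = size a + size b + 1 := by
  simp [size, code_pair]

@[simp] theorem size_nil : size ([] : List α) = 1 := rfl

@[simp] theorem size_cons (a : α) (l : List α) : size (a :: l) = size a + size l + 1 := by
  simp [size, code_cons]

theorem length_lt_size (l : List α) : l.length < size l := by
  induction l with
  | nil => simp
  | cons a l ih => simp; omega

theorem size_le_of_mem {a : α} {l : List α} (h : a ∈ l) : size a ≤ size l := by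
  induction l with
  | nil => simp at h
  | cons b l ih =>
    rcases List.mem_cons.1 h with rfl | h
    · simp; omega
    · have := ih h; simp; omega

/-! ### Polynomial bounds. -/

theorem eval_mono (p : Polynomial ℕ) : Monotone fun n => p.eval n := by
  intro m n h
  simp only [Polynomial.eval_eq_sum, Polynomial.sum]
  gcongr

/-- `t` is bounded by a polynomial in the size of the argument. -/
def PolyBound (t : α → ℕ) : Prop := ∃ p : Polynomial ℕ, ∀ a, t a ≤ p.eval (size a)

namespace PolyBound

theorem mono {t t' : α → ℕ} (h : PolyBound t) (h' : ∀ a, t' a ≤ t a) : PolyBound t' :=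
  let ⟨p, hp⟩ := h
  ⟨p, fun a => (h' a).trans (hp a)⟩

theorem const (n : ℕ) : PolyBound fun _ : α => n := ⟨.C n, by simp⟩

theorem id : PolyBound (size : α → ℕ) := ⟨.X, by simp⟩

theorem add {t t' : α → ℕ} (h : PolyBound t) (h' : PolyBound t') :
    PolyBound fun a => t a + t' a :=
  let ⟨p, hp⟩ := h
  let ⟨q, hq⟩ := h'
  ⟨p + q, fun a => by simpa using add_le_add (hp a) (hq a)⟩

theorem mul {t t' : α → ℕ} (h : PolyBound t) (h' : PolyBound t') :
    PolyBound fun a => t a * t' a :=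
  let ⟨p, hp⟩ := h
  let ⟨q, hq⟩ := h'
  ⟨p * q, fun a => by simpa using Nat.mul_le_mul (hp a) (hq a)⟩

theorem eval {t : α → ℕ} (p : Polynomial ℕ) (h : PolyBound t) :
    PolyBound fun a => p.eval (t a) :=
  let ⟨q, hq⟩ := h
  ⟨p.comp q, fun a => by simpa using eval_mono p (hq a)⟩

theorem comp {t : β → ℕ} {f : α → β} (h : PolyBound t) (hf : PolyBound fun a => size (f a)) :
    PolyBound fun a => t (f a) :=
  let ⟨p, hp⟩ := h
  (hf.eval p).mono fun _ => hp _

end PolyBound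

/-- `F` replaces the code of `a` on top of the main stack by the code of `f a` within `t a`
steps. -/
def Computes (F : Frag) (f : α → β) (t : α → ℕ) : Prop :=
  ∀ a m, F.Runs (onMain (code a ++ m)) (onMain (code (f a) ++ m)) (t a)

/-- `f` is computed by a fragment in polynomial time. -/
def PolyTime (f : α → β) : Prop := ∃ F t, PolyBound t ∧ Computes F f t

theorem runs_drop_code (a : α) (m : List Symbol) :
    drop.Runs (onMain (code a ++ m)) (onMain m) (6 * size a + 3) := runs_drop _ m

theorem runs_dup_code (a : α) (m : List Symbol) :
    dup.Runs (onMain (code a ++ m)) (onMain (code a ++ (code a ++ m))) (12 * size a + 5) :=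
  runs_dup _ m

theorem runs_swap_code (a : α) (b : β) (m : List Symbol) :
    swap.Runs (onMain (code a ++ (code b ++ m))) (onMain (code b ++ (code a ++ m)))
      (11 * (size a + size b) + 7) := runs_swap _ _ m

namespace PolyTime

/-- The output is at most as long as the input plus the number of steps. This is what makes
compositions polynomial. -/
theorem size_bound {f : α → β} (h : PolyTime f) : PolyBound fun a => size (f a) := by
  obtain ⟨F, t, ht, hF⟩ := h
  refine (PolyBound.id.add ht).mono fun a => ?_
  simpa [size] using (hF a []).length_le .main

theorem of_eq {f g : α → β} (h : PolyTime f) (hfg : ∀ a, f a = g a) : PolyTime g :=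
  (funext hfg : f = g) ▸ h

/-- A fragment sees only codes, so changes of type that leave the tree alone are free: a number and
its digits, a pair and a cons cell. -/
theorem recode {f : α → β} {g : α → γ} (h : PolyTime f)
    (hfg : ∀ a, Enc.tree (g a) = Enc.tree (f a)) : PolyTime g := by
  obtain ⟨F, t, ht, hF⟩ := h
  refine ⟨F, t, ht, fun a m => ?_⟩
  simpa [code, hfg] using hF a m

protected theorem id : PolyTime (fun a : α => a) :=
  ⟨skip, _, .const 0, fun _ _ => runs_skip _⟩

theorem comp {g : β → γ} {f : α → β} (hg : PolyTime g) (hf : PolyTime f) :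
    PolyTime fun a => g (f a) := by
  have hs := hf.size_bound
  obtain ⟨F, t, ht, hF⟩ := hf
  obtain ⟨G, u, hu, hG⟩ := hg
  exact ⟨F.seq G, _, ht.add (hu.comp hs), fun a m => (hF a m).seq (hG (f a) m)⟩

/-- Push the code of a tree. -/
def pushTree : BTree → Frag
  | .leaf b => push .main (some b)
  | .node l r => ((pushTree r).seq (pushTree l)).seq (push .main none)

theorem runs_pushTree (t : BTree) (m : List Symbol) :
    (pushTree t).Runs (onMain m) (onMain (t.code ++ m)) t.code.length := by
  induction t generalizing m with
  | leaf b => exact runs_push_main _ _ _ _ _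
  | node l r ihl ihr =>
    have h := ((ihr m).seq (ihl _)).seq (runs_push_main none _ _ _ _)
    simpa [pushTree, BTree.code, Nat.add_comm] using h

theorem const (b : β) : PolyTime fun _ : α => b :=
  ⟨drop.seq (pushTree (Enc.tree b)), fun a => 6 * size a + 3 + size b,
    (((PolyBound.const 6).mul .id).add (.const 3)).add (.const _),
    fun a m => (runs_drop_code a m).seq (runs_pushTree _ _)⟩

theorem pair {f : α → β} {g : α → γ} (hf : PolyTime f) (hg : PolyTime g) :
    PolyTime fun a => (f a, g a) := by
  have hs := hg.size_bound
  obtain ⟨F, t, ht, hF⟩ := hf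
  obtain ⟨G, u, hu, hG⟩ := hg
  refine ⟨(((dup.seq G).seq swap).seq F).seq (push .main none),
    fun a => 12 * size a + 5 + u a + (11 * (size (g a) + size a) + 7) + t a + 1, ?_,
    fun a m => ?_⟩
  · exact ((((((PolyBound.const 12).mul .id).add (.const 5)).add hu).add
      (((PolyBound.const 11).mul (hs.add .id)).add (.const 7))).add ht).add (.const 1)
  · simpa [code_pair] using ((((runs_dup_code a m).seq (hG a _)).seq (runs_swap_code _ a m)).seq
      (hF a _)).seq (runs_push_main none _ _ _ _)

theorem fst : PolyTime (Prod.fst : α × β → α) := by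
  refine ⟨(case fun _ => swap).seq drop,
    fun x => 11 * size x + 8 + (6 * size x + 3), ?_, fun x m => ?_⟩
  · exact (((PolyBound.const 11).mul .id).add (.const 8)).add
      (((PolyBound.const 6).mul .id).add (.const 3))
  · obtain ⟨a, b⟩ := x
    have := (Runs.case (F := fun _ => swap) (x := none) (runs_swap_code a b m)).seq
      (runs_drop_code b (code a ++ m))
    simpa [code_pair] using this.mono
      (show _ ≤ 11 * size (a, b) + 8 + (6 * size (a, b) + 3) by rw [size_pair]; omega)

theorem snd : PolyTime (Prod.snd : α × β → β) := by
  refine ⟨case fun _ => drop, fun x => 6 * size x + 4, ?_, fun x m => ?_⟩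
  · exact ((PolyBound.const 6).mul .id).add (.const 4)
  · obtain ⟨a, b⟩ := x
    have := Runs.case (F := fun _ => drop) (x := none) (runs_drop_code a (code b ++ m))
    simpa [code_pair] using this.mono
      (show _ ≤ 6 * size (a, b) + 4 by rw [size_pair]; omega)

theorem cond {c : α → Bool} {f g : α → β} (hc : PolyTime c) (hf : PolyTime f) (hg : PolyTime g) :
    PolyTime fun a => bif c a then f a else g a := by
  obtain ⟨C, s, hs, hC⟩ := hc
  obtain ⟨F, t, ht, hF⟩ := hf
  obtain ⟨G, u, hu, hG⟩ := hg
  refine ⟨(dup.seq C).seq (case (select skip F G)),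
    fun a => 12 * size a + 5 + s a + (t a + u a + 1), ?_, fun a m => ?_⟩
  · exact ((((PolyBound.const 12).mul .id).add (.const 5)).add hs).add
      ((ht.add hu).add (.const 1))
  · refine ((runs_dup_code a m).seq (hC a _)).seq (Runs.case ?_)
    beta_reduce
    cases c a
    · exact (hG a m).mono (Nat.le_add_left _ _)
    · exact (hF a m).mono (Nat.le_add_right _ _)

theorem listCases {f : α → List β} {g : α → γ} {h : α → β → List β → γ} (hf : PolyTime f)
    (hg : PolyTime g) (hh : PolyTime fun x : α × β × List β => h x.1 x.2.1 x.2.2) :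
    PolyTime fun a => match f a with
      | [] => g a
      | b :: l => h a b l := by
  have hfs := hf.size_bound
  obtain ⟨F, s, hs, hF⟩ := hf
  obtain ⟨G, t, ht, hG⟩ := hg
  obtain ⟨H, u, ⟨p, hp⟩, hH⟩ := hh
  -- After the node symbol of a nonempty list is popped, the codes of head and tail remain. One push
  -- turns them into a pair, `swap` brings the context to the top, and a second push forms the
  -- argument of `H`.
  refine ⟨(dup.seq F).seq (case (select
      ((((push .main none).seq swap).seq (push .main none)).seq H) G G)),
    fun a => 12 * size a + 5 + s a + (t a + (1 + (11 * (size (f a) + size a) + 7) + 1 +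
      p.eval (size a + size (f a) + 1)) + 1), ?_, fun a m => ?_⟩
  · exact ((((PolyBound.const 12).mul .id).add (.const 5)).add hs).add
      ((ht.add ((((PolyBound.const 1).add (((PolyBound.const 11).mul (hfs.add .id)).add
        (.const 7))).add (.const 1)).add (((PolyBound.id.add hfs).add (.const 1)).eval p))).add
          (.const 1))
  · refine ((runs_dup_code a m).seq (hF a _)).seq ?_
    beta_reduce
    rcases hfa : f a with _ | ⟨b, l⟩
    · exact Runs.case (F := select _ G G) ((hG a m).mono (Nat.le_add_right _ _))
    · rw [code_cons]
      refine Runs.case (F := select _ G G) ?_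
      have hsw : swap.Runs (onMain (none :: (code b ++ code l) ++ (code a ++ m)))
          (onMain (code a ++ (code (b, l) ++ m))) (11 * (size (b, l) + size a) + 7) :=
        runs_swap_code (b, l) a m
      have hH' : H.Runs (onMain (none :: (code a ++ (code (b, l) ++ m))))
          (onMain (code (h a b l) ++ m)) (p.eval (size a + size (b :: l) + 1)) := by
        have := (hH (a, b, l) m).mono ((hp _).trans (eval_mono p
          (show size (a, b, l) ≤ size a + size (b :: l) + 1 by simp)))
        simpa [code_pair] using this
      have := (((runs_push_main none _ _ _ _).seq hsw).seq (runs_push_main none _ _ _ _)).seq hH'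
      refine Runs.mono this ?_
      rw [size_pair, size_cons]
      omega

/-- One round of a fold; the stack holds an element, the rest of the list, the accumulator and the
context. -/
theorem foldl_step {h : α → σ → β → σ} (hh : PolyTime fun x : α × σ × β => h x.1 x.2.1 x.2.2) :
    PolyTime fun x : ((β × List β) × σ) × α => ((x.1.1.2, h x.2 x.1.2 x.1.1.1), x.2) := by
  have hp : PolyTime fun x : ((β × List β) × σ) × α => x.1.1 := fst.comp fst
  have hs : PolyTime fun x : ((β × List β) × σ) × α => x.1.2 := snd.comp fst
  exact ((snd.comp hp).pair (hh.comp (snd.pair (hs.pair (fst.comp hp))))).pair snd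

/-- Iterating a polynomial-time step can make the accumulator grow exponentially, so a bound on all
intermediate accumulators, the folds over prefixes, has to be supplied. Each round then costs a
fixed polynomial in the size of the context. -/
theorem foldl {f : α → List β} {g : α → σ} {h : α → σ → β → σ} (hf : PolyTime f)
    (hg : PolyTime g) (hh : PolyTime fun x : α × σ × β => h x.1 x.2.1 x.2.2)
    {B : α → ℕ} (hB : PolyBound B)
    (hsize : ∀ a l, l <+: f a → size (l.foldl (h a) (g a)) ≤ B a) :
    PolyTime fun a => (f a).foldl (h a) (g a) := by
  have hfs := hf.size_bound
  obtain ⟨I, s, hs, hI⟩ := (hf.pair hg).pair .id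
  obtain ⟨H, u, ⟨p, hp⟩, hH⟩ := foldl_step hh
  let body : Frag := (((((push .main none).seq (push .main none)).seq (push .main none)).seq
    H).seq (case fun _ => skip)).seq (case fun _ => skip)
  let loop : Frag := branch .main (select body skip skip) isNode
  -- One round runs `H` and spends six further steps: three pushes that build the nested pairs, two
  -- pops that open the result, and the pop that inspects the list.
  let T : α → ℕ := fun a => p.eval (size (f a) + B a + size a + 3) + 6
  have hbody : ∀ a (b : β) (l : List β) (x : σ) m,
      size (((b, l), x), a) ≤ size (f a) + B a + size a + 3 →
      body.Runs (onMain (code b ++ (code l ++ (code x ++ (code a ++ m)))))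
        (onMain (code l ++ (code (h a x b) ++ (code a ++ m)))) (T a - 1) := by
    intro a b l x m hle
    have h₁ : H.Runs (onMain (none :: none :: none ::
        (code b ++ (code l ++ (code x ++ (code a ++ m))))))
        (onMain (none :: none :: (code l ++ (code (h a x b) ++ (code a ++ m)))))
        (p.eval (size (f a) + B a + size a + 3)) := by
      have := (hH (((b, l), x), a) m).mono ((hp _).trans (eval_mono p hle))
      simpa [code_pair] using this
    have h₂ := ((((((runs_push_main none (code b ++ (code l ++ (code x ++ (code a ++ m))))
      [] [] []).seq (runs_push_main none _ _ _ _)).seq (runs_push_main none _ _ _ _)).seq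
      h₁).seq (Runs.case (F := fun _ => skip) (runs_skip _))).seq
      (Runs.case (F := fun _ => skip) (runs_skip _)))
    refine h₂.mono ?_
    simp only [T]
    omega
  -- Loop invariant: `k` has been processed and `l` remains, so the accumulator is a fold over a
  -- prefix and `hsize` applies to it.
  have hloop : ∀ a m (l k : List β), k ++ l = f a →
      loop.Runs (onMain (code l ++ (code (k.foldl (h a) (g a)) ++ (code a ++ m))))
        (onMain (code ((f a).foldl (h a) (g a)) ++ (code a ++ m))) (l.length * T a + 1) := by
    intro a m l
    induction l with
    | nil =>
      intro k hk
      rw [List.append_nil] at hk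
      subst hk
      have h₁ := runs_skip (onMain (code ((f a).foldl (h a) (g a)) ++ (code a ++ m)))
      have h₂ := Runs.branch_exit (k := .main) (F := select body skip skip) (back := isNode)
        (s := onMain (code ([] : List β) ++ (code ((f a).foldl (h a) (g a)) ++ (code a ++ m))))
        rfl (by simpa [code_nil, select] using h₁)
      exact h₂.mono (by omega)
    | cons b l ih =>
      intro k hk
      have hk' : (k ++ [b]) ++ l = f a := by simpa using hk
      have hs₁ : size (k.foldl (h a) (g a)) ≤ B a := hsize a k ⟨_, hk⟩
      have hs₂ : size (b :: l) ≤ size (f a) := by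
        rw [← hk]
        clear hk hk' hs₁
        induction k with
        | nil => simp
        | cons c k ih => rw [List.cons_append, size_cons c]; omega
      have hb := hbody a b l (k.foldl (h a) (g a)) m (by simp at hs₂ ⊢; omega)
      have := ih (k ++ [b]) hk'
      rw [List.foldl_append] at this
      have hr : loop.Runs _ _ _ := Runs.branch_back (F := select body skip skip)
        (s := onMain (code (b :: l) ++ (code (k.foldl (h a) (g a)) ++ (code a ++ m)))) rfl
        (by simpa [code_cons, select] using hb) this
      refine hr.mono ?_
      have : 1 ≤ T a := by simp only [T]; omega
      rw [List.length_cons, Nat.succ_mul]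
      omega
  refine ⟨((((I.seq (case fun _ => skip)).seq (case fun _ => skip)).seq loop).seq swap).seq drop,
    fun a => s a + 1 + 1 + (size (f a) * T a + 1) + (11 * (B a + size a) + 7) +
      (6 * size a + 3), ?_, fun a m => ?_⟩
  · have hT : PolyBound T := ((((hfs.add hB).add .id).add (.const 3)).eval p).add (.const 6)
    exact ((((hs.add (.const 1)).add (.const 1)).add ((hfs.mul hT).add (.const 1))).add
      (((PolyBound.const 11).mul (hB.add .id)).add (.const 7))).add
      (((PolyBound.const 6).mul .id).add (.const 3))
  · have h₁ : I.Runs (onMain (code a ++ m))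
        (onMain (none :: none :: (code (f a) ++ (code (g a) ++ (code a ++ m))))) (s a) := by
      simpa [code_pair] using hI a m
    have h₂ := ((((h₁.seq (Runs.case (F := fun _ => skip) (runs_skip _))).seq
      (Runs.case (F := fun _ => skip) (runs_skip _))).seq (hloop a m (f a) [] rfl)).seq
      (runs_swap_code _ a m)).seq (runs_drop_code a _)
    refine h₂.mono ?_
    beta_reduce
    have h₃ := hsize a (f a) (List.prefix_refl _)
    have h₄ : (f a).length * T a ≤ size (f a) * T a :=
      Nat.mul_le_mul_right _ (length_lt_size _).le
    omega

end PolyTime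

end StackMachine

/-!
## Strings as lists of symbols
-/

namespace StackMachine

open WMISP (Symbol)
open Frag

instance : Enc Symbol := ⟨fun
  | none => .node (.leaf false) (.leaf false)
  | some b => .leaf b⟩

theorem code_symbol_some (b : Bool) : code (some b : Symbol) = [some b] := rfl

theorem code_symbol_none : code (none : Symbol) = [none, some false, some false] := rfl

theorem size_symbol_le (x : Symbol) : size x ≤ 3 := by
  cases x <;> simp [size, code_symbol_some, code_symbol_none]

theorem size_symbols_le (l : List Symbol) : size l ≤ 4 * l.length + 1 := by
  induction l with
  | nil => simp
  | cons x l ih => have := size_symbol_le x; simp; omega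

abbrev mainToAux : Frag := forEach .main (push .aux)

theorem runs_mainToAux (m a b c : List Symbol) :
    mainToAux.Runs (st m a b c) (st [] (m.reverse ++ a) b c) (2 * m.length + 1) := by
  induction m generalizing a with
  | nil => exact runs_forEach_nil rfl
  | cons x m ih =>
    have := Runs.forEach_cons (k := .main) (F := push .aux) (s := st (x :: m) a b c) rfl
      (by simpa using runs_push_aux x m a b c) (ih (x :: a))
    simpa using this.mono (by simp; omega)

/-- Prepend a symbol to the list that is coded on the main stack. -/
def pushSymbol : Symbol → Frag
  | some b => (push .main (some b)).seq (push .main none)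
  | none => (((push .main (some false)).seq (push .main (some false))).seq
      (push .main none)).seq (push .main none)

theorem runs_pushSymbol (x : Symbol) (l m a b c : List Symbol) :
    (pushSymbol x).Runs (st (code l ++ m) a b c) (st (code (x :: l) ++ m) a b c) 4 := by
  cases x with
  | some y =>
    exact ((runs_push_main _ _ _ _ _).seq (runs_push_main _ _ _ _ _)).mono (by omega)
  | none =>
    exact (((runs_push_main _ _ _ _ _).seq (runs_push_main _ _ _ _ _)).seq
      (runs_push_main _ _ _ _ _)).seq (runs_push_main _ _ _ _ _)

theorem runs_forEach_pushSymbol (a l m b c : List Symbol) :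
    (forEach .aux pushSymbol).Runs (st (code l ++ m) a b c)
      (st (code (a.reverse ++ l) ++ m) [] b c) (5 * a.length + 1) := by
  induction a generalizing l with
  | nil => exact runs_forEach_nil rfl
  | cons x a ih =>
    have := Runs.forEach_cons (k := .aux) (F := pushSymbol) (s := st (code l ++ m) (x :: a) b c)
      rfl (by simpa using runs_pushSymbol x l m a b c) (ih (x :: l))
    simpa using this.mono (by simp; omega)

/-- Replace a string by its code. -/
def encodeString : Frag := (mainToAux.seq (push .main (some false))).seq (forEach .aux pushSymbol)

theorem runs_encodeString (l : List Symbol) :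
    encodeString.Runs (onMain l) (onMain (code l)) (7 * l.length + 3) := by
  have h := runs_forEach_pushSymbol l.reverse [] [] [] []
  rw [List.reverse_reverse, List.append_nil, List.append_nil, List.append_nil] at h
  have h₁ := runs_mainToAux l [] [] []
  rw [List.append_nil] at h₁
  refine ((h₁.seq (runs_push_main (some false) _ _ _ _)).seq h).mono ?_
  simp; omega

/-- Move a coded symbol from the main stack to the auxiliary stack. -/
def popSymbol : Frag :=
  branch .main (select ((branch .main (fun _ => skip) fun _ => false).seq
    ((branch .main (fun _ => skip) fun _ => false).seq (push .aux none)))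
    (push .aux (some true)) (push .aux (some false))) fun _ => false

theorem runs_popSymbol (x : Symbol) (m a : List Symbol) :
    popSymbol.Runs (st (code x ++ m) a [] []) (st m (x :: a) [] []) 4 := by
  have hpop : ∀ y m, (branch .main (fun _ => skip) fun _ => false).Runs (st (y :: m) a [] [])
      (st m a [] []) 1 := fun y m =>
    Runs.branch_exit (F := fun _ => skip) (t := 0) rfl (by simpa using runs_skip (st m a [] []))
  rcases x with _ | _ | _
  · refine Runs.branch_exit (t := 3) rfl ?_
    simpa [code_symbol_none, select] using
      (hpop (some false) (some false :: m)).seq ((hpop _ _).seq (runs_push_aux none m a [] []))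
  all_goals
    refine Runs.mono (Runs.branch_exit (t := 1) rfl ?_) (show 2 ≤ 4 by omega)
    simpa [code_symbol_some, select] using runs_push_aux (some _) m a [] []

abbrev decodeToAux : Frag := branch .main (select popSymbol skip skip) isNode

theorem runs_decodeToAux (l a : List Symbol) :
    decodeToAux.Runs (st (code l) a [] []) (st [] (l.reverse ++ a) [] []) (5 * l.length + 1) := by
  induction l generalizing a with
  | nil =>
    refine Runs.branch_exit (t := 0) rfl ?_
    simpa [code_nil, select] using runs_skip (st [] a [] [])
  | cons x l ih =>
    have h := runs_popSymbol x (code l) a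
    have := Runs.branch_back (k := .main) (F := select popSymbol skip skip) (back := isNode)
      (s := st (code (x :: l)) a [] []) rfl (by simpa [code_cons, select] using h) (ih (x :: a))
    refine Runs.mono (F := decodeToAux) (t := 4 + 1 + (5 * l.length + 1)) ?_ (by simp; omega)
    simpa using this

def decodeString : Frag := decodeToAux.seq auxToMain

theorem runs_decodeString (l : List Symbol) :
    decodeString.Runs (onMain (code l)) (onMain l) (7 * l.length + 2) := by
  have h := (runs_decodeToAux l []).seq (runs_auxToMain _ _ _ _)
  simp only [List.append_nil, List.reverse_reverse, List.length_reverse] at h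
  exact h.mono (by omega)

/-- The machine works on raw strings, the class `PolyTime` on coded lists; conversion in either
direction takes linear time. -/
theorem PolyTime.computableInPolyTime {A B : Type} {ea : A → List Symbol} {eb : B → List Symbol}
    {f : A → B} {g : List Symbol → List Symbol} (hg : PolyTime g)
    (hf : ∀ a, g (ea a) = eb (f a)) : Nonempty (Turing.TM2ComputableInPolyTime ea eb f) := by
  obtain ⟨q, hq⟩ := hg.size_bound
  obtain ⟨G, t, ⟨p, hp⟩, hG⟩ := hg
  -- A symbol occupies at most three places in the code of a list, plus one for its node, and the
  -- end of the list occupies one more; hence `4 * .X + 1`.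
  refine ⟨((encodeString.seq G).seq decodeString).computableInPolyTime
    (7 * .X + 3 + p.comp (4 * .X + 1) + (7 * q.comp (4 * .X + 1) + 2)) fun a => ?_⟩
  have h := hG (ea a) []
  rw [List.append_nil, List.append_nil] at h
  rw [← hf]
  refine (((runs_encodeString (ea a)).seq h).seq (runs_decodeString (g (ea a)))).mono ?_
  have h₁ : t (ea a) ≤ p.eval (4 * (ea a).length + 1) :=
    (hp _).trans (eval_mono p (size_symbols_le _))
  have h₂ : (g (ea a)).length ≤ q.eval (4 * (ea a).length + 1) :=
    (length_lt_size _).le.trans ((hq _).trans (eval_mono q (size_symbols_le _)))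
  simp only [Polynomial.eval_add, Polynomial.eval_mul, Polynomial.eval_X, Polynomial.eval_comp,
    Polynomial.eval_ofNat, Polynomial.eval_one]
  omega

end StackMachine

/-!
## Lists, natural numbers and fractions
-/

namespace StackMachine

open WMISP (Symbol Fraction)

variable {α β γ σ : Type} [Enc α] [Enc β] [Enc γ] [Enc σ]

namespace PolyTime

theorem fst' {f : α → β × γ} (hf : PolyTime f) : PolyTime fun a => (f a).1 := fst.comp hf

theorem snd' {f : α → β × γ} (hf : PolyTime f) : PolyTime fun a => (f a).2 := snd.comp hf

theorem comp₂ {r : α → β → γ} {f : σ → α} {g : σ → β} (hr : PolyTime fun x : α × β => r x.1 x.2)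
    (hf : PolyTime f) (hg : PolyTime g) : PolyTime fun s => r (f s) (g s) :=
  hr.comp (hf.pair hg)

theorem not {f : α → Bool} (hf : PolyTime f) : PolyTime fun a => !f a :=
  (hf.cond (const false) (const true)).of_eq fun a => by cases f a <;> rfl

theorem and {f g : α → Bool} (hf : PolyTime f) (hg : PolyTime g) :
    PolyTime fun a => f a && g a :=
  (hf.cond hg (const false)).of_eq fun a => by cases f a <;> rfl

theorem or {f g : α → Bool} (hf : PolyTime f) (hg : PolyTime g) :
    PolyTime fun a => f a || g a :=
  (hf.cond (const true) hg).of_eq fun a => by cases f a <;> rfl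

theorem xor {f g : α → Bool} (hf : PolyTime f) (hg : PolyTime g) :
    PolyTime fun a => f a ^^ g a :=
  (hf.cond hg.not hg).of_eq fun a => by cases f a <;> simp

theorem cons {f : α → β} {g : α → List β} (hf : PolyTime f) (hg : PolyTime g) :
    PolyTime fun a => f a :: g a :=
  (hf.pair hg).recode fun _ => rfl

theorem tail {f : α → List β} (hf : PolyTime f) : PolyTime fun a => (f a).tail :=
  (hf.listCases (const []) (snd.comp snd)).of_eq fun a => by cases f a <;> rfl

theorem headD {f : α → List β} {g : α → β} (hf : PolyTime f) (hg : PolyTime g) :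
    PolyTime fun a => (f a).headD (g a) :=
  (hf.listCases hg (fst.comp snd)).of_eq fun a => by cases f a <;> rfl

theorem isEmpty {f : α → List β} (hf : PolyTime f) : PolyTime fun a => (f a).isEmpty :=
  (hf.listCases (const true) (const false)).of_eq fun a => by cases f a <;> rfl

/-- Folding is possible in polynomial time if some potential that bounds the size polynomially
grows in each step by at most an amount that depends on the context only. -/
theorem foldl_of_potential {f : α → List β} {g : α → σ} {h : α → σ → β → σ} (hf : PolyTime f)
    (hg : PolyTime g) (hh : PolyTime fun x : α × σ × β => h x.1 x.2.1 x.2.2)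
    (μ : σ → ℕ) (P : Polynomial ℕ) (hP : ∀ s, size s ≤ P.eval (μ s)) (hμ : ∀ s, μ s ≤ size s)
    {q : α → ℕ} (hq : PolyBound q) (hstep : ∀ a s, ∀ b ∈ f a, μ (h a s b) ≤ μ s + q a) :
    PolyTime fun a => (f a).foldl (h a) (g a) := by
  refine hf.foldl hg hh (B := fun a => P.eval (size (g a) + size (f a) * q a))
    ((hg.size_bound.add (hf.size_bound.mul hq)).eval P) fun a l hl => (hP _).trans
      (eval_mono P ?_)
  have : ∀ (l : List β) s, (∀ b ∈ l, b ∈ f a) →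
      μ (l.foldl (h a) s) ≤ μ s + l.length * q a := by
    intro l
    induction l with
    | nil => simp
    | cons b l ih =>
      intro s hl
      have h₁ := ih (h a s b) fun c hc => hl c (List.mem_cons_of_mem _ hc)
      have h₂ := hstep a s b (hl b List.mem_cons_self)
      rw [List.foldl_cons, List.length_cons, Nat.succ_mul]
      omega
  refine (this l _ fun b hb => hl.subset hb).trans (add_le_add (hμ _) ?_)
  exact Nat.mul_le_mul_right _ (hl.length_le.trans (length_lt_size _).le)

theorem foldl_of_le {f : α → List β} {g : α → σ} {h : α → σ → β → σ} (hf : PolyTime f)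
    (hg : PolyTime g) (hh : PolyTime fun x : α × σ × β => h x.1 x.2.1 x.2.2)
    {q : α → ℕ} (hq : PolyBound q)
    (hstep : ∀ a s, ∀ b ∈ f a, size (h a s b) ≤ size s + q a) :
    PolyTime fun a => (f a).foldl (h a) (g a) :=
  hf.foldl_of_potential hg hh size .X (by simp) (by simp) hq hstep

theorem reverse {f : α → List β} (hf : PolyTime f) : PolyTime fun a => (f a).reverse := by
  refine (hf.foldl_of_le (g := fun _ => []) (h := fun _ s b => b :: s) (const [])
    ((snd' snd).cons (fst' snd)) (hf.size_bound.add (.const 1)) fun a s b hb => ?_).of_eq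
      fun a => ?_
  · have := size_le_of_mem hb
    simp; omega
  · simp

theorem foldr_of_le {f : α → List β} {g : α → σ} {h : α → β → σ → σ} (hf : PolyTime f)
    (hg : PolyTime g) (hh : PolyTime fun x : α × β × σ => h x.1 x.2.1 x.2.2)
    {q : α → ℕ} (hq : PolyBound q)
    (hstep : ∀ a s, ∀ b ∈ f a, size (h a b s) ≤ size s + q a) :
    PolyTime fun a => (f a).foldr (h a) (g a) :=
  (hf.reverse.foldl_of_le (h := fun a s b => h a b s) hg
    (hh.comp (fst.pair ((snd' snd).pair (fst' snd)))) hq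
    (fun a s b hb => hstep a s b (by simpa using hb))).of_eq fun a => by simp

theorem append {f g : α → List β} (hf : PolyTime f) (hg : PolyTime g) :
    PolyTime fun a => f a ++ g a := by
  refine (hf.foldr_of_le (h := fun _ b s => b :: s) hg ((fst' snd).cons (snd' snd))
    (hf.size_bound.add (.const 1)) fun a s b hb => ?_).of_eq fun a => ?_
  · have := size_le_of_mem hb
    simp; omega
  · simp

theorem size_tail_le (l : List α) : size l.tail ≤ size l := by
  cases l with
  | nil => simp
  | cons a l => simp; omega

/-- Drop as many elements from one list as another list has. -/
theorem drop {f : α → List β} {g : α → List γ} (hf : PolyTime f) (hg : PolyTime g) :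
    PolyTime fun a => (f a).drop (g a).length := by
  refine (hg.foldl_of_le (h := fun _ s _ => s.tail) hf (fst' snd).tail (.const 0)
    fun a s b _ => size_tail_le s).of_eq fun a => ?_
  generalize f a = l
  induction g a generalizing l with
  | nil => simp
  | cons b k ih => rw [List.foldl_cons, ih, List.length_cons, List.drop_tail]

theorem any {f : α → List β} {p : α → β → Bool} (hf : PolyTime f)
    (hp : PolyTime fun x : α × β => p x.1 x.2) : PolyTime fun a => (f a).any (p a) := by
  refine (hf.foldl_of_le (g := fun _ => false) (h := fun a s b => s || p a b) (const false)
    ((fst' snd).or (hp.comp₂ fst (snd' snd))) (.const 0) fun a s b _ => by simp).of_eq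
      fun a => ?_
  suffices ∀ (l : List β) s, l.foldl (fun s b => s || p a b) s = (s || l.any (p a)) by
    simpa using this (f a) false
  intro l
  induction l with
  | nil => simp
  | cons b l ih => intro s; simp [ih, Bool.or_assoc]

end PolyTime

/-! ### Natural numbers -/

instance : Enc ℕ := ⟨fun n => Enc.tree n.bits⟩

theorem size_nat (n : ℕ) : size n = 2 * n.size + 1 := by
  have : size n = size n.bits := rfl
  rw [this, ← Nat.size_eq_bits_len]
  induction n.bits with
  | nil => simp
  | cons b l ih => simp [ih]; omega

theorem size_nat_mono {m n : ℕ} (h : m ≤ n) : size m ≤ size n := by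
  have := Nat.size_le_size h
  rw [size_nat, size_nat]; omega

namespace PolyTime

theorem bits {f : α → ℕ} (hf : PolyTime f) : PolyTime fun a => (f a).bits :=
  hf.recode fun _ => rfl

theorem ofBits {f : α → ℕ} (hf : PolyTime fun a => (f a).bits) : PolyTime f :=
  hf.recode fun _ => rfl

theorem bodd {f : α → ℕ} (hf : PolyTime f) : PolyTime fun a => (f a).bodd :=
  (hf.bits.headD (const false)).of_eq fun a => by
    rw [Nat.bodd_eq_bits_head]; cases (f a).bits <;> rfl

theorem div2 {f : α → ℕ} (hf : PolyTime f) : PolyTime fun a => (f a).div2 :=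
  ofBits (hf.bits.tail.of_eq fun _ => (Nat.div2_bits_eq_tail _).symm)

theorem bit {f : α → Bool} {g : α → ℕ} (hf : PolyTime f) (hg : PolyTime g) :
    PolyTime fun a => Nat.bit (f a) (g a) := by
  -- The digits of a number do not end in a zero, so prepending a zero digit to the empty list must
  -- give the empty list.
  refine ofBits (((hg.bits.isEmpty.and hf.not).cond (const []) (hf.cons hg.bits)).of_eq
    fun a => ?_)
  rcases Nat.eq_zero_or_pos (g a) with h | h
  · rw [h]; cases f a <;> simp
  · rw [Nat.bits_append_bit _ _ fun h' => absurd h' h.ne']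
    have : (g a).bits ≠ [] := fun h' => h.ne' (by
      rw [← Nat.size_eq_zero, ← Nat.size_eq_bits_len, h']; rfl)
    cases h' : (g a).bits with
    | nil => exact absurd h' this
    | cons b l => rfl

end PolyTime

theorem size_bit_le (b : Bool) (n : ℕ) : size (Nat.bit b n) ≤ size n + 2 := by
  rw [size_nat, size_nat]
  have : (Nat.bit b n).size ≤ n.size + 1 := by
    rw [Nat.size_le, pow_succ, Nat.bit_val]
    have := Nat.lt_size_self n
    cases b <;> simp <;> omega
  omega

/-- The number with the given binary digits, least significant digit first. -/
def natOfBits (l : List Bool) : ℕ := l.foldr Nat.bit 0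

theorem natOfBits_bits (n : ℕ) : natOfBits n.bits = n := by
  induction n using Nat.binaryRec' with
  | zero => simp [natOfBits]
  | bit b n h ih => rw [Nat.bits_append_bit _ _ h]; exact congrArg (Nat.bit b) ih

theorem PolyTime.natOfBits {f : α → List Bool} (hf : PolyTime f) :
    PolyTime fun a => natOfBits (f a) :=
  hf.foldr_of_le (g := fun _ => 0) (h := fun _ => Nat.bit) (const 0)
    (PolyTime.bit (fst' snd) (snd' snd)) (.const 2) fun _ _ _ _ => size_bit_le _ _

/-! ### Addition in binary. -/

theorem natOfBits_append (l : List Bool) (b : Bool) :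
    natOfBits (l ++ [b]) = natOfBits l + 2 ^ l.length * b.toNat := by
  induction l with
  | nil => cases b <;> rfl
  | cons c l ih =>
    have h : ∀ l, natOfBits (c :: l) = 2 * natOfBits l + c.toNat := fun l => Nat.bit_val _ _
    rw [List.cons_append, h, h, ih, List.length_cons, pow_succ]
    ring

/-- One step of the addition of binary numbers; the state consists of the carry, the remaining
digits and the sum digits so far, most significant digit first. -/
def addStep (s : (Bool × ℕ × ℕ) × List Bool) : (Bool × ℕ × ℕ) × List Bool :=
  ((bif s.1.1 then s.1.2.1.bodd || s.1.2.2.bodd else s.1.2.1.bodd && s.1.2.2.bodd,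
    s.1.2.1.div2, s.1.2.2.div2), (s.1.1 ^^ (s.1.2.1.bodd ^^ s.1.2.2.bodd)) :: s.2)

/-- The part of the sum that is still to be processed. -/
def addRest (s : (Bool × ℕ × ℕ) × List Bool) : ℕ := s.1.1.toNat + s.1.2.1 + s.1.2.2

/-- This is the identity of a full adder: the emitted digit is the parity of the rest, and the new
carry accounts for what halving leaves over. -/
theorem addRest_eq (s : (Bool × ℕ × ℕ) × List Bool) :
    addRest s = (s.1.1 ^^ (s.1.2.1.bodd ^^ s.1.2.2.bodd)).toNat + 2 * addRest (addStep s) := by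
  obtain ⟨⟨c, x, y⟩, l⟩ := s
  have hx := Nat.bodd_add_div2 x
  have hy := Nat.bodd_add_div2 y
  simp only [addRest, addStep]
  generalize x.div2 = x' at *
  generalize y.div2 = y' at *
  generalize x.bodd = b at *
  generalize y.bodd = b' at *
  subst hx hy
  cases c <;> cases b <;> cases b' <;> simp <;> omega

theorem addStep_invariant (k : ℕ) (s : (Bool × ℕ × ℕ) × List Bool) :
    natOfBits (addStep^[k] s).2.reverse + 2 ^ (addStep^[k] s).2.length * addRest (addStep^[k] s) =
      natOfBits s.2.reverse + 2 ^ s.2.length * addRest s := by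
  induction k with
  | zero => rfl
  | succ k ih =>
    rw [Function.iterate_succ_apply', ← ih, addRest_eq (addStep^[k] s)]
    generalize addStep^[k] s = u
    have : (addStep u).2 = (u.1.1 ^^ (u.1.2.1.bodd ^^ u.1.2.2.bodd)) :: u.2 := rfl
    rw [this, List.reverse_cons, natOfBits_append, List.length_cons, List.length_reverse, pow_succ]
    ring

theorem addRest_iterate_lt (k j : ℕ) (s : (Bool × ℕ × ℕ) × List Bool)
    (h : addRest s < 2 ^ (j + k)) : addRest (addStep^[k] s) < 2 ^ j := by
  induction k generalizing s with
  | zero => exact h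
  | succ k ih =>
    rw [Function.iterate_succ_apply]
    refine ih _ ?_
    have := addRest_eq s
    rw [← Nat.add_assoc, pow_succ] at h
    omega

/-- The sum is less than `2 ^ (x.size + y.size + 1)` and every round halves the rest. After this
many rounds the rest is 0, and by the invariant the emitted digits represent the whole sum. -/
theorem natOfBits_addStep (x y : ℕ) :
    natOfBits (addStep^[x.size + y.size + 1] ((false, x, y), [])).2.reverse = x + y := by
  have h := addStep_invariant (x.size + y.size + 1) ((false, x, y), [])
  have h₁ : addRest (addStep^[x.size + y.size + 1] ((false, x, y), [])) < 2 ^ 0 := by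
    refine addRest_iterate_lt _ _ _ ?_
    have hx := Nat.lt_size_self x
    have hy := Nat.lt_size_self y
    have h₁ : 2 ^ x.size ≤ 2 ^ (x.size + y.size) := Nat.pow_le_pow_right (by omega) (by omega)
    have h₂ : 2 ^ y.size ≤ 2 ^ (x.size + y.size) := Nat.pow_le_pow_right (by omega) (by omega)
    rw [Nat.zero_add, pow_succ]
    simp only [addRest, Bool.toNat_false]
    omega
  have h₂ : addRest (addStep^[x.size + y.size + 1] ((false, x, y), [])) = 0 := by simpa using h₁
  rw [h₂, mul_zero, add_zero] at h
  rw [h]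
  simp [natOfBits, addRest]

theorem size_div2_le (n : ℕ) : size n.div2 ≤ size n :=
  size_nat_mono (by rw [Nat.div2_val]; omega)

/-- A function can be iterated as often as the length of a list if it increases sizes by at most a
constant. -/
theorem PolyTime.iterate {f : α → List β} {g : α → σ} {h : σ → σ} (hf : PolyTime f)
    (hg : PolyTime g) (hh : PolyTime h) (c : ℕ) (hc : ∀ s, size (h s) ≤ size s + c) :
    PolyTime fun a => h^[(f a).length] (g a) :=
  (hf.foldl_of_le (h := fun _ s _ => h s) hg (hh.comp (fst' snd)) (.const c)
    fun _ s _ _ => hc s).of_eq fun a => by rw [List.foldl_const]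

theorem PolyTime.addStep : PolyTime addStep := by
  have hc : PolyTime fun s : (Bool × ℕ × ℕ) × List Bool => s.1.1 := fst' fst
  have hx : PolyTime fun s : (Bool × ℕ × ℕ) × List Bool => s.1.2.1 := fst' (snd' fst)
  have hy : PolyTime fun s : (Bool × ℕ × ℕ) × List Bool => s.1.2.2 := snd' (snd' fst)
  exact ((hc.cond (hx.bodd.or hy.bodd) (hx.bodd.and hy.bodd)).pair (hx.div2.pair hy.div2)).pair
    ((hc.xor (hx.bodd.xor hy.bodd)).cons snd)

theorem PolyTime.add {f g : α → ℕ} (hf : PolyTime f) (hg : PolyTime g) :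
    PolyTime fun a => f a + g a := by
  -- Only the length of this list matters: it counts the rounds of the adder in unary.
  have hl : PolyTime fun a => (f a).bits ++ ((g a).bits ++ [true]) :=
    hf.bits.append (hg.bits.append (const _))
  refine (((hl.iterate (((const false).pair (hf.pair hg)).pair (const [])) PolyTime.addStep 2
    fun s => ?_).snd').reverse.natOfBits).of_eq fun a => ?_
  · have h₁ := size_div2_le s.1.2.1
    have h₂ := size_div2_le s.1.2.2
    obtain ⟨⟨c, x, y⟩, l⟩ := s
    simp only [StackMachine.addStep, size_pair, size_cons, size_bool] at *
    omega
  · have : ((f a).bits ++ ((g a).bits ++ [true])).length = (f a).size + (g a).size + 1 := by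
      simp [Nat.size_eq_bits_len, Nat.add_assoc]
    rw [this, natOfBits_addStep]

/-- One step of the comparison of binary numbers, starting with the least significant digits. -/
def leStep (s : Bool × ℕ × ℕ) : Bool × ℕ × ℕ :=
  (bif s.2.1.bodd ^^ s.2.2.bodd then s.2.2.bodd else s.1, s.2.1.div2, s.2.2.div2)

/-- The flag is the verdict of the digits already read and decides only if the remaining parts
agree, since a later digit is more significant and overrides it. -/
theorem leStep_invariant (k : ℕ) (s : Bool × ℕ × ℕ) :
    ((leStep^[k] s).2.1 < (leStep^[k] s).2.2 ∨
      (leStep^[k] s).2.1 = (leStep^[k] s).2.2 ∧ (leStep^[k] s).1 = true) ↔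
    (s.2.1 < s.2.2 ∨ s.2.1 = s.2.2 ∧ s.1 = true) := by
  induction k generalizing s with
  | zero => rfl
  | succ k ih =>
    rw [Function.iterate_succ_apply, ih]
    obtain ⟨c, x, y⟩ := s
    have hx := Nat.bodd_add_div2 x
    have hy := Nat.bodd_add_div2 y
    simp only [leStep]
    generalize x.div2 = x' at *
    generalize y.div2 = y' at *
    cases c <;> cases hx' : x.bodd <;> cases hy' : y.bodd <;> simp [hx', hy'] at * <;> omega

theorem leStep_iterate (k : ℕ) (s : Bool × ℕ × ℕ) :
    (leStep^[k] s).2 = (s.2.1 / 2 ^ k, s.2.2 / 2 ^ k) := by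
  induction k with
  | zero => simp
  | succ k ih =>
    rw [Function.iterate_succ_apply']
    simp [leStep, ih, Nat.div2_val, Nat.div_div_eq_div_mul, pow_succ]

theorem leStep_size (x y : ℕ) : (leStep^[x.size + y.size] (true, x, y)).1 = decide (x ≤ y) := by
  have h := leStep_invariant (x.size + y.size) (true, x, y)
  rw [leStep_iterate] at h
  have h₁ : x / 2 ^ (x.size + y.size) = 0 := Nat.div_eq_of_lt
    ((Nat.lt_size_self x).trans_le (Nat.pow_le_pow_right (by omega) (by omega)))
  have h₂ : y / 2 ^ (x.size + y.size) = 0 := Nat.div_eq_of_lt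
    ((Nat.lt_size_self y).trans_le (Nat.pow_le_pow_right (by omega) (by omega)))
  simp only [h₁, h₂, lt_irrefl, true_and, false_or, and_true] at h
  rw [Bool.eq_iff_iff, h, decide_eq_true_iff, le_iff_lt_or_eq]

theorem PolyTime.leStep : PolyTime leStep := by
  have hx : PolyTime fun s : Bool × ℕ × ℕ => s.2.1 := fst' snd
  have hy : PolyTime fun s : Bool × ℕ × ℕ => s.2.2 := snd' snd
  exact ((hx.bodd.xor hy.bodd).cond hy.bodd fst).pair (hx.div2.pair hy.div2)

theorem PolyTime.natLe {f g : α → ℕ} (hf : PolyTime f) (hg : PolyTime g) :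
    PolyTime fun a => decide (f a ≤ g a) := by
  refine (((hf.bits.append hg.bits).iterate ((const true).pair (hf.pair hg)) PolyTime.leStep 0
    fun s => ?_).fst').of_eq fun a => ?_
  · have h₁ := size_div2_le s.2.1
    have h₂ := size_div2_le s.2.2
    obtain ⟨c, x, y⟩ := s
    simp only [StackMachine.leStep, size_pair, size_bool] at *
    omega
  · have : ((f a).bits ++ (g a).bits).length = (f a).size + (g a).size := by
      simp [Nat.size_eq_bits_len]
    rw [this, leStep_size]

/-! ### Multiplication in binary. -/

theorem nat_size_add_le (x y : ℕ) : (x + y).size ≤ max x.size y.size + 1 := by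
  rw [Nat.size_le, pow_succ]
  have hx := (Nat.lt_size_self x).trans_le
    (Nat.pow_le_pow_right (by omega) (le_max_left x.size y.size) : _ ≤ 2 ^ _)
  have hy := (Nat.lt_size_self y).trans_le
    (Nat.pow_le_pow_right (by omega) (le_max_right x.size y.size) : _ ≤ 2 ^ _)
  omega

theorem nat_size_mul_le (x y : ℕ) : (x * y).size ≤ x.size + y.size := by
  rw [Nat.size_le, pow_add]
  exact Nat.mul_lt_mul'' (Nat.lt_size_self x) (Nat.lt_size_self y)

/-- Horner's scheme over the digits of the second factor, from the most significant one. A round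
doubles the accumulator and possibly adds `f a`, so its size grows by an amount depending on the
context only. -/
theorem PolyTime.mul {f g : α → ℕ} (hf : PolyTime f) (hg : PolyTime g) :
    PolyTime fun a => f a * g a := by
  refine (hg.bits.foldr_of_le (g := fun _ => 0)
    (h := fun a b s => bif b then Nat.bit false s + f a else Nat.bit false s)
    (q := fun a => size (f a) + 4) (const 0) ?_ (hf.size_bound.add (.const 4))
    fun a s b _ => ?_).of_eq fun a => ?_
  · have hs : PolyTime fun x : α × Bool × ℕ => Nat.bit false x.2.2 := (const false).bit (snd' snd)
    exact (fst' snd).cond (hs.add (hf.comp fst)) hs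
  · have h₁ := nat_size_add_le (Nat.bit false s) (f a)
    have h₂ := size_bit_le false s
    simp only [size_nat] at *
    cases b <;> simp only [cond_true, cond_false] <;> omega
  · have : ∀ l : List Bool, l.foldr (fun b s => bif b then Nat.bit false s + f a
        else Nat.bit false s) 0 = f a * StackMachine.natOfBits l := by
      intro l
      induction l with
      | nil => rfl
      | cons b l ih =>
        rw [List.foldr_cons, ih]
        have : StackMachine.natOfBits (b :: l) = Nat.bit b (StackMachine.natOfBits l) := rfl
        rw [this, Nat.bit_val, Nat.bit_val]
        cases b <;> simp <;> ring
    rw [this, natOfBits_bits]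

/-! ### Fractions -/

instance : Enc ℕ+ := ⟨fun n => Enc.tree (n : ℕ)⟩

namespace PolyTime

theorem val {f : α → ℕ+} (hf : PolyTime f) : PolyTime fun a => (f a : ℕ) :=
  hf.recode fun _ => rfl

theorem ofVal {f : α → ℕ+} (hf : PolyTime fun a => (f a : ℕ)) : PolyTime f :=
  hf.recode fun _ => rfl

theorem toPNat' {f : α → ℕ} (hf : PolyTime f) : PolyTime fun a => (f a).toPNat' :=
  ofVal (((hf.natLe (const 0)).cond (const 1) hf).of_eq fun a => by
    cases h : f a <;> simp)

end PolyTime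

/-- Leaving the result unreduced avoids computing greatest common divisors. -/
def fracAdd (x y : Fraction) : Fraction := (x.1 * y.2 + y.1 * x.2, x.2 * y.2)

def fracLe (x y : Fraction) : Bool := decide (x.1 * (y.2 : ℕ) ≤ y.1 * (x.2 : ℕ))

def fracMax (x y : Fraction) : Fraction := bif fracLe x y then y else x

theorem value_fracAdd (x y : Fraction) : (fracAdd x y).value = x.value + y.value := by
  have hx : ((x.2 : ℕ) : ℚ) ≠ 0 := by simp
  have hy : ((y.2 : ℕ) : ℚ) ≠ 0 := by simp
  simp only [Fraction.value, fracAdd]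
  rw [div_add_div _ _ hx hy]
  push_cast
  ring

theorem fracLe_iff (x y : Fraction) : fracLe x y = true ↔ x.value ≤ y.value := by
  have hx : (0 : ℚ) < ((x.2 : ℕ) : ℚ) := by simp
  have hy : (0 : ℚ) < ((y.2 : ℕ) : ℚ) := by simp
  rw [fracLe, decide_eq_true_iff, Fraction.value, Fraction.value, div_le_div_iff₀ hx hy]
  norm_cast

theorem value_fracMax (x y : Fraction) : (fracMax x y).value = max x.value y.value := by
  rw [fracMax]
  cases h : fracLe x y
  · rw [← Bool.not_eq_true, fracLe_iff, not_le] at h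
    exact (max_eq_left h.le).symm
  · rw [fracLe_iff] at h
    exact (max_eq_right h).symm

theorem value_nonneg (x : Fraction) : 0 ≤ x.value := by
  rw [Fraction.value]; positivity

@[simp] theorem value_zero : Fraction.value (0, 1) = 0 := by simp [Fraction.value]

/-- The larger number of binary digits of numerator and denominator. -/
def fracSize (x : Fraction) : ℕ := max x.1.size (x.2 : ℕ).size

theorem size_fraction (x : Fraction) : size x = 2 * x.1.size + 2 * (x.2 : ℕ).size + 3 := by
  have : size x = size (x.1, (x.2 : ℕ)) := rfl
  rw [this, size_pair, size_nat, size_nat]; omega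

theorem fracSize_le_size (x : Fraction) : fracSize x ≤ size x := by
  rw [size_fraction, fracSize]; omega

/-- The denominator of `x` enters both the new numerator and the new denominator, so the code size
can about double in one addition. The larger of the two digit counts grows only additively and
therefore serves as the potential for sums. -/
theorem fracSize_fracAdd_le (x y : Fraction) :
    fracSize (fracAdd x y) ≤ fracSize x + (fracSize y + 1) := by
  have h₁ := nat_size_add_le (x.1 * y.2) (y.1 * x.2)
  have h₂ := nat_size_mul_le x.1 y.2
  have h₃ := nat_size_mul_le y.1 x.2
  have h₄ := nat_size_mul_le x.2 y.2
  simp only [fracSize, fracAdd, PNat.mul_coe]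
  omega

theorem size_fracMax_le (x y : Fraction) : size (fracMax x y) ≤ size x + size y := by
  rw [fracMax]; cases fracLe x y <;> simp

namespace PolyTime

theorem fracAdd {f g : α → Fraction} (hf : PolyTime f) (hg : PolyTime g) :
    PolyTime fun a => fracAdd (f a) (g a) :=
  ((hf.fst'.mul hg.snd'.val).add (hg.fst'.mul hf.snd'.val)).pair
    (ofVal ((hf.snd'.val.mul hg.snd'.val).of_eq fun _ => (PNat.mul_coe _ _).symm))

theorem fracLe {f g : α → Fraction} (hf : PolyTime f) (hg : PolyTime g) :
    PolyTime fun a => fracLe (f a) (g a) :=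
  (hf.fst'.mul hg.snd'.val).natLe (hg.fst'.mul hf.snd'.val)

theorem fracMax {f g : α → Fraction} (hf : PolyTime f) (hg : PolyTime g) :
    PolyTime fun a => fracMax (f a) (g a) :=
  (hf.fracLe hg).cond hg hf

end PolyTime

/-- The sum of `r b` over the elements `b` of a list. -/
def sumOver {B : Type} (l : List B) (r : B → Fraction) : Fraction :=
  l.foldl (fun s b => fracAdd s (r b)) (0, 1)

/-- The maximum of `0` and `r b` over the elements `b` of a list. -/
def maxOver {B : Type} (l : List B) (r : B → Fraction) : Fraction :=
  l.foldl (fun s b => fracMax s (r b)) (0, 1)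

theorem value_sumOver {B : Type} (l : List B) (r : B → Fraction) :
    (sumOver l r).value = (l.map fun b => (r b).value).sum := by
  suffices ∀ s, (l.foldl (fun s b => fracAdd s (r b)) s).value =
      s.value + (l.map fun b => (r b).value).sum by simpa [sumOver] using this (0, 1)
  induction l with
  | nil => simp
  | cons b l ih => intro s; simp [ih, value_fracAdd, add_assoc]

theorem value_maxOver_le_iff {B : Type} (l : List B) (r : B → Fraction) {q : ℚ} (hq : 0 ≤ q) :
    (maxOver l r).value ≤ q ↔ ∀ b ∈ l, (r b).value ≤ q := by
  suffices ∀ s, (l.foldl (fun s b => fracMax s (r b)) s).value ≤ q ↔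
      s.value ≤ q ∧ ∀ b ∈ l, (r b).value ≤ q by simpa [maxOver, hq] using this (0, 1)
  induction l with
  | nil => simp
  | cons b l ih => intro s; simp [ih, value_fracMax, and_assoc]

theorem value_le_maxOver {B : Type} {l : List B} {b : B} (r : B → Fraction) (hb : b ∈ l) :
    (r b).value ≤ (maxOver l r).value :=
  (value_maxOver_le_iff l r (value_nonneg _)).1 le_rfl b hb

theorem value_maxOver_mem {B : Type} (l : List B) (r : B → Fraction) {p : ℚ → Prop} (h₀ : p 0)
    (h : ∀ b ∈ l, p (r b).value) : p (maxOver l r).value := by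
  suffices ∀ s : Fraction, p s.value → p (l.foldl (fun s b => fracMax s (r b)) s).value from
    this (0, 1) (by simpa using h₀)
  induction l with
  | nil => exact fun s hs => hs
  | cons b l ih =>
    intro s hs
    refine ih (fun c hc => h c (List.mem_cons_of_mem _ hc)) _ ?_
    rw [value_fracMax]
    rcases max_choice s.value (r b).value with h' | h' <;> rw [h']
    · exact hs
    · exact h b List.mem_cons_self

namespace PolyTime

/-- The size of a function value at the elements of a list is bounded in terms of the context. -/
theorem size_bound_of_mem {f : α → List β} {r : α → β → σ} (hf : PolyTime f)
    (hr : PolyTime fun x : α × β => r x.1 x.2) :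
    ∃ q : α → ℕ, PolyBound q ∧ ∀ a, ∀ b ∈ f a, size (r a b) ≤ q a := by
  obtain ⟨p, hp⟩ := hr.size_bound
  refine ⟨_, ((PolyBound.id.add hf.size_bound).add (.const 1)).eval p, fun a b hb =>
    (hp (a, b)).trans (eval_mono p ?_)⟩
  have := size_le_of_mem hb
  rw [size_pair]; omega

theorem sumOver {f : α → List β} {r : α → β → Fraction} (hf : PolyTime f)
    (hr : PolyTime fun x : α × β => r x.1 x.2) : PolyTime fun a => sumOver (f a) (r a) := by
  obtain ⟨q, hq, hq'⟩ := hf.size_bound_of_mem hr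
  change PolyTime fun a => (f a).foldl (fun s b => StackMachine.fracAdd s (r a b)) (0, 1)
  refine hf.foldl_of_potential (g := fun _ => ((0, 1) : Fraction))
    (h := fun a s b => StackMachine.fracAdd s (r a b)) (const _)
    ((fst' snd).fracAdd (hr.comp₂ fst (snd' snd))) fracSize (4 * .X + 3) (fun s => ?_)
    fracSize_le_size (hq.add (.const 1)) fun a s b hb => ?_
  · rw [size_fraction]
    simp [fracSize]
    omega
  · have h₁ := fracSize_fracAdd_le s (r a b)
    have h₂ := fracSize_le_size (r a b)
    have h₃ := hq' a b hb
    omega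

theorem maxOver {f : α → List β} {r : α → β → Fraction} (hf : PolyTime f)
    (hr : PolyTime fun x : α × β => r x.1 x.2) : PolyTime fun a => maxOver (f a) (r a) := by
  obtain ⟨q, hq, hq'⟩ := hf.size_bound_of_mem hr
  change PolyTime fun a => (f a).foldl (fun s b => StackMachine.fracMax s (r a b)) (0, 1)
  refine hf.foldl_of_le (g := fun _ => ((0, 1) : Fraction))
    (h := fun a s b => StackMachine.fracMax s (r a b)) (const _)
    ((fst' snd).fracMax (hr.comp₂ fst (snd' snd))) hq fun a s b hb => ?_
  exact (size_fracMax_le _ _).trans (Nat.add_le_add_left (hq' a b hb) _)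

end PolyTime

end StackMachine

/-!
## The algorithm
-/

namespace StackMachine

open WMISP (Symbol Fraction)
open Frag

variable {α β γ σ : Type} [Enc α] [Enc β] [Enc γ] [Enc σ]

namespace PolyTime

/-- Replace a coded symbol by a bit. -/
def symbolToBit (n s t : Bool) : Frag :=
  case (select ((case fun _ => skip).seq ((case fun _ => skip).seq (push .main (some n))))
    (push .main (some t)) (push .main (some s)))

theorem symbolToBit_computes (n s t : Bool) : Computes (symbolToBit n s t)
    (fun x : Symbol => x.elim n fun b => bif b then t else s) fun _ => 4 := by
  intro x m
  have hskip : ∀ y m, (case fun _ => skip).Runs (onMain (y :: m)) (onMain m) 1 :=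
    fun y m => Runs.case (runs_skip _)
  rcases x with _ | _ | _
  · exact Runs.case (F := select _ _ _) ((hskip _ _).seq ((hskip _ m).seq
      (runs_push_main (some n) m [] [] [])))
  · refine Runs.mono (Runs.case (x := some false) (t := 1) ?_) (show 2 ≤ 4 by omega)
    exact runs_push_main (some s) m [] [] []
  · refine Runs.mono (Runs.case (x := some true) (t := 1) ?_) (show 2 ≤ 4 by omega)
    exact runs_push_main (some t) m [] [] []

theorem isNone {f : α → Symbol} (hf : PolyTime f) : PolyTime fun a => (f a).isNone :=
  (comp (f := f) ⟨_, _, .const 4, symbolToBit_computes true false false⟩ hf).of_eq fun a => by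
    rcases f a with _ | _ | _ <;> rfl

theorem getD {f : α → Symbol} (hf : PolyTime f) : PolyTime fun a => (f a).getD false :=
  (comp (f := f) ⟨_, _, .const 4, symbolToBit_computes false false true⟩ hf).of_eq fun a => by
    rcases f a with _ | _ | _ <;> rfl

end PolyTime

/-! ### Reading the input -/

/-- Reads one symbol of the input string, from right to left. The state tells whether a denominator
is being read, and holds the pairs consisting of row and numerator, and denominator. -/
def parseStep (x : Symbol) (s : Bool × List (List Bool × List Bool)) :
    Bool × List (List Bool × List Bool) :=
  bif x.isNone then bif s.1 then (false, s.2) else (true, ([], []) :: s.2)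
  else match s.2 with
    | [] => s
    | y :: l => bif s.1 then (true, (y.1, x.getD false :: y.2) :: l)
      else (false, (x.getD false :: y.1, y.2) :: l)

/-- Read from the right, separators alternately announce a denominator and a numerator preceded by a
row. Row and numerator stay joined because the number of vertices is known only after the whole
string has been split. -/
def parse (l : List Symbol) : List (List Bool × List Bool) := (l.foldr parseStep (false, [])).2

theorem foldr_parseStep_false (c : List Bool) (y : List Bool × List Bool)
    (l : List (List Bool × List Bool)) :
    (c.map some).foldr parseStep (false, y :: l) = (false, (c ++ y.1, y.2) :: l) := by
  induction c with
  | nil => rfl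
  | cons b c ih => rw [List.map_cons, List.foldr_cons, ih]; rfl

theorem foldr_parseStep_true (d : List Bool) (y : List Bool × List Bool)
    (l : List (List Bool × List Bool)) :
    (d.map some).foldr parseStep (true, y :: l) = (true, (y.1, d ++ y.2) :: l) := by
  induction d with
  | nil => rfl
  | cons b d ih => rw [List.map_cons, List.foldr_cons, ih]; rfl

theorem foldr_parseStep (l : List (List Bool × List Bool)) :
    (l.flatMap fun y => y.1.map some ++ [none] ++ y.2.map some ++ [none]).foldr parseStep
      (false, []) = (false, l) := by
  induction l with
  | nil => rfl
  | cons y l ih =>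
    rw [List.flatMap_cons, List.foldr_append, ih, List.foldr_append, List.foldr_append,
      List.foldr_append]
    have h₁ : List.foldr parseStep (false, l) [none] = (true, ([], []) :: l) := rfl
    have h₂ : List.foldr parseStep (true, ([], y.2 ++ []) :: l) [none] =
      (false, ([], y.2 ++ []) :: l) := rfl
    rw [h₁, foldr_parseStep_true, h₂, foldr_parseStep_false]
    simp

theorem PolyTime.parse {f : α → List Symbol} (hf : PolyTime f) :
    PolyTime fun a => parse (f a) := by
  refine (hf.foldr_of_le (g := fun _ => (false, [])) (h := fun _ => parseStep) (const _) ?_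
    (.const 4) fun a s x _ => ?_).snd'
  · let Y := List Bool × List Bool
    have hx : PolyTime fun x : α × Symbol × Bool × List Y => x.2.1 := fst' snd
    have hs : PolyTime fun x : α × Symbol × Bool × List Y => x.2.2 := snd' snd
    have hc : PolyTime fun x : (α × Symbol × Bool × List Y) × Y × List Y => x.1 := fst
    have hy : PolyTime fun x : (α × Symbol × Bool × List Y) × Y × List Y => x.2.1 := fst' snd
    have hl : PolyTime fun x : (α × Symbol × Bool × List Y) × Y × List Y => x.2.2 := snd' snd
    have hb := (hx.comp hc).getD
    have h := hs.snd'.listCases (h := fun x (y : Y) l => bif x.2.2.1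
      then (true, (y.1, x.2.1.getD false :: y.2) :: l)
      else (false, (x.2.1.getD false :: y.1, y.2) :: l)) hs
      ((hs.comp hc).fst'.cond
        ((const true).pair ((hy.fst'.pair (hb.cons hy.snd')).cons hl))
        ((const false).pair (((hb.cons hy.fst').pair hy.snd').cons hl)))
    refine (hx.isNone.cond (hs.fst'.cond ((const false).pair hs.snd')
      ((const true).pair ((const ([], [])).cons hs.snd'))) h).of_eq fun x => ?_
    obtain ⟨_, x, b, l⟩ := x
    cases l
    all_goals rfl
  · obtain ⟨b, l⟩ := s
    rcases x with _ | x
    · cases b <;> simp [parseStep]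
      omega
    · rcases l with _ | ⟨y, l⟩
      · simp [parseStep]
      · obtain ⟨c, d⟩ := y
        cases b <;> simp [parseStep] <;> omega

/-- A vertex is represented by its index in unary, a list that starts with its row of the adjacency
matrix, and its weight. -/
abbrev Vertex : Type := List Bool × List Bool × Fraction

/-- The row keeps the digits of the numerator at its end; this is harmless, since only positions
below `n` are looked up. The default of `toPNat'` at 0 never occurs for an encoded instance, whose
denominators are positive. -/
def vertexOf (n : ℕ) (i : List Bool) (y : List Bool × List Bool) : Vertex :=
  (i, y.1, natOfBits (y.1.drop n), (natOfBits y.2).toPNat')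

def vertexStep (n : ℕ) (s : List Bool × List Vertex) (y : List Bool × List Bool) :
    List Bool × List Vertex :=
  (false :: s.1, vertexOf n s.1 y :: s.2)

def vertices (l : List (List Bool × List Bool)) : List Vertex :=
  (l.foldl (vertexStep l.length) ([], [])).2

theorem foldl_vertexStep (n : ℕ) (l : List (List Bool × List Bool)) :
    l.foldl (vertexStep n) ([], []) = (List.replicate l.length false,
      (l.mapIdx fun i y => vertexOf n (List.replicate i false) y).reverse) := by
  induction l using List.reverseRecOn with
  | nil => rfl
  | append_singleton l y ih =>
    rw [List.foldl_append, ih, List.mapIdx_append]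
    simp [vertexStep, List.replicate_succ]

theorem size_le_of_forall {l : List α} {q : ℕ} (h : ∀ a ∈ l, size a ≤ q) :
    size l ≤ l.length * (q + 1) + 1 := by
  induction l with
  | nil => simp
  | cons a l ih =>
    have h₁ := ih fun b hb => h b (List.mem_cons_of_mem _ hb)
    have h₂ := h a List.mem_cons_self
    rw [size_cons, List.length_cons, Nat.succ_mul]
    omega

theorem size_replicate_bool (n : ℕ) (b : Bool) : size (List.replicate n b) = 2 * n + 1 := by
  induction n with
  | zero => simp
  | succ n ih => simp [List.replicate_succ, ih]; omega

/-- The new record contains the index held in the accumulator, so its size is not bounded by the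
context for an arbitrary accumulator. The closed form `foldl_vertexStep` bounds the accumulators
that actually occur. -/
theorem PolyTime.vertices {f : α → List (List Bool × List Bool)} (hf : PolyTime f) :
    PolyTime fun a => vertices (f a) := by
  have hv : PolyTime fun x : α × List Bool × List Bool × List Bool =>
      vertexOf (f x.1).length x.2.1 x.2.2 :=
    (fst' snd).pair ((fst' (snd' snd)).pair (((fst' (snd' snd)).drop (hf.comp fst)).natOfBits.pair
      (snd' (snd' snd)).natOfBits.toPNat'))
  obtain ⟨p, hp⟩ := hv.size_bound
  let q : α → ℕ := fun a => p.eval (size a + (2 * size (f a) + 1 + size (f a) + 1) + 1)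
  have hq : PolyBound q := ((PolyBound.id.add (((((PolyBound.const 2).mul hf.size_bound).add
    (.const 1)).add hf.size_bound).add (.const 1))).add (.const 1)).eval p
  refine (hf.foldl (g := fun _ => ([], [])) (h := fun a => vertexStep (f a).length) (const _) ?_
    (B := fun a => 2 * size (f a) + 1 + (size (f a) * (q a + 1) + 1) + 1) ?_ ?_).snd'
  · have hs : PolyTime fun x : α × (List Bool × List Vertex) × List Bool × List Bool => x.2.1 :=
      fst' snd
    exact ((const false).cons hs.fst').pair
      ((hv.comp (fst.pair (hs.fst'.pair (snd' snd)))).cons hs.snd')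
  · exact ((((PolyBound.const 2).mul hf.size_bound).add (.const 1)).add ((hf.size_bound.mul
      (hq.add (.const 1))).add (.const 1))).add (.const 1)
  · intro a l hl
    have hlen : l.length ≤ size (f a) := hl.length_le.trans (length_lt_size _).le
    have h : size (l.mapIdx fun i y =>
        vertexOf (f a).length (List.replicate i false) y).reverse ≤ l.length * (q a + 1) + 1 := by
      refine (size_le_of_forall (q := q a) fun v hv => ?_).trans (by simp)
      rw [List.mem_reverse, List.mem_mapIdx] at hv
      obtain ⟨i, hi, rfl⟩ := hv
      refine (hp (a, List.replicate i false, l[i])).trans (eval_mono p ?_)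
      have := size_le_of_mem (hl.subset (List.getElem_mem hi))
      rw [size_pair, size_pair, size_replicate_bool]
      omega
    have h' := Nat.mul_le_mul_right (q a + 1) hlen
    rw [foldl_vertexStep, size_pair, size_replicate_bool]
    omega

/-! ### Candidates for an optimal solution -/

namespace Vertex

def adj (u v : Vertex) : Bool := (u.2.1.drop v.1.length).headD false

/-- The index of `u` is smaller than the index of `v`. -/
def before (u v : Vertex) : Bool := !(v.1.drop u.1.length).isEmpty

def same (u v : Vertex) : Bool := !before u v && !before v u

def cyclic (u v w : Vertex) : Bool := adj u v && (adj v w && adj w u)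

/-- `u` is smaller than `v` with respect to weight and, in case of a tie, index. -/
def lighter (u v : Vertex) : Bool :=
  fracLe u.2.2 v.2.2 && (!fracLe v.2.2 u.2.2 || before u v)

/-- Some three vertices satisfy `p`. -/
def any₃ (l : List Vertex) (p : Vertex → Vertex → Vertex → Bool) : Bool :=
  l.any fun u => l.any fun v => l.any fun w => p u v w

/-- The weight of the set of vertices defined by `p` if it is independent, and `0` otherwise. -/
def weight (l : List Vertex) (p : Vertex → Bool) : Fraction :=
  bif any₃ l fun u v w => p u && (p v && (p w && cyclic u v w)) then (0, 1)
  else sumOver l fun u => bif p u then u.2.2 else (0, 1)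

/-- `u` is not the lightest vertex of any cyclic triangle. -/
def kept (l : List Vertex) (u : Vertex) : Bool :=
  !l.any fun v => l.any fun w => cyclic u v w && (lighter u v && lighter u w)

/-- The maximum weight of a closed out-neighbourhood, a closed in-neighbourhood, the set of vertices
that are not lightest in a cyclic triangle, or a set of at most three vertices. -/
def best (l : List Vertex) : Fraction :=
  fracMax
    (fracMax (maxOver l fun v => weight l fun u => same v u || adj v u)
      (maxOver l fun v => weight l fun u => !adj v u))
    (fracMax (weight l (kept l))
      (maxOver l fun u => maxOver l fun v => maxOver l fun w =>
        weight l fun x => same x u || (same x v || same x w)))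

end Vertex

namespace PolyTime

section

variable {u v w : α → Vertex} (hu : PolyTime u) (hv : PolyTime v) (hw : PolyTime w)
include hu hv

theorem adj : PolyTime fun a => (u a).adj (v a) :=
  (hu.snd'.fst'.drop hv.fst').headD (const false)

theorem before : PolyTime fun a => (u a).before (v a) := (hv.fst'.drop hu.fst').isEmpty.not

theorem same : PolyTime fun a => (u a).same (v a) := (hu.before hv).not.and (hv.before hu).not

theorem lighter : PolyTime fun a => (u a).lighter (v a) :=
  (hu.snd'.snd'.fracLe hv.snd'.snd').and ((hv.snd'.snd'.fracLe hu.snd'.snd').not.or (hu.before hv))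

include hw

theorem cyclic : PolyTime fun a => (u a).cyclic (v a) (w a) :=
  (hu.adj hv).and ((hv.adj hw).and (hw.adj hu))

end

theorem weight {l : α → List Vertex} {p : α → Vertex → Bool} (hl : PolyTime l)
    (hp : PolyTime fun x : α × Vertex => p x.1 x.2) :
    PolyTime fun a => Vertex.weight (l a) (p a) := by
  refine cond ?_ (const _) (hl.sumOver (hp.cond snd.snd'.snd' (const _)))
  refine hl.any (hl.comp fst |>.any (hl.comp (fst.comp fst) |>.any ?_))
  have ha : PolyTime fun x : ((α × Vertex) × Vertex) × Vertex => x.1.1.1 := fst.fst'.fst'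
  have hu : PolyTime fun x : ((α × Vertex) × Vertex) × Vertex => x.1.1.2 := fst.fst'.snd'
  have hv : PolyTime fun x : ((α × Vertex) × Vertex) × Vertex => x.1.2 := fst.snd'
  exact (hp.comp₂ ha hu).and ((hp.comp₂ ha hv).and ((hp.comp₂ ha snd).and (hu.cyclic hv snd)))

theorem kept {l : α → List Vertex} {u : α → Vertex} (hl : PolyTime l) (hu : PolyTime u) :
    PolyTime fun a => Vertex.kept (l a) (u a) := by
  refine not (hl.any (hl.comp fst |>.any ?_))
  have hu' : PolyTime fun x : (α × Vertex) × Vertex => u x.1.1 := hu.comp fst.fst'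
  have hv : PolyTime fun x : (α × Vertex) × Vertex => x.1.2 := fst.snd'
  exact (hu'.cyclic hv snd).and ((hu'.lighter hv).and (hu'.lighter snd))

theorem best {l : α → List Vertex} (hl : PolyTime l) : PolyTime fun a => Vertex.best (l a) := by
  have hl₁ : PolyTime fun x : α × Vertex => l x.1 := hl.comp fst
  have hl₂ : PolyTime fun x : (α × Vertex) × Vertex => l x.1.1 := hl₁.comp fst
  have hl₃ : PolyTime fun x : ((α × Vertex) × Vertex) × Vertex => l x.1.1.1 := hl₂.comp fst
  have hv : PolyTime fun x : (α × Vertex) × Vertex => x.1.2 := fst.snd'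
  have hw : PolyTime fun x : (α × Vertex) × Vertex => x.2 := snd
  have h₁ : PolyTime fun x : α × Vertex =>
      Vertex.weight (l x.1) fun u => x.2.same u || x.2.adj u :=
    weight (p := fun (x : α × Vertex) u => x.2.same u || x.2.adj u) hl₁
      ((hv.same hw).or (hv.adj hw))
  have h₂ : PolyTime fun x : α × Vertex => Vertex.weight (l x.1) fun u => !x.2.adj u :=
    weight (p := fun (x : α × Vertex) u => !x.2.adj u) hl₁ (hv.adj hw).not
  have h₃ : PolyTime fun a => Vertex.weight (l a) (Vertex.kept (l a)) :=
    weight (p := fun a => Vertex.kept (l a)) hl (hl₁.kept snd)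
  have h₄ : PolyTime fun x : ((α × Vertex) × Vertex) × Vertex =>
      Vertex.weight (l x.1.1.1) fun y => y.same x.1.1.2 || (y.same x.1.2 || y.same x.2) := by
    refine weight (p := fun (x : ((α × Vertex) × Vertex) × Vertex) y =>
      y.same x.1.1.2 || (y.same x.1.2 || y.same x.2)) hl₃ ?_
    have hy : PolyTime fun x : (((α × Vertex) × Vertex) × Vertex) × Vertex => x.2 := snd
    have hx : PolyTime fun x : (((α × Vertex) × Vertex) × Vertex) × Vertex => x.1 := fst
    exact (hy.same hx.fst'.fst'.snd').or ((hy.same hx.fst'.snd').or (hy.same hx.snd'))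
  have h₅ := hl₂.maxOver (r := fun (x : (α × Vertex) × Vertex) (w : Vertex) =>
    Vertex.weight (l x.1.1) fun y => y.same x.1.2 || (y.same x.2 || y.same w)) h₄
  have h₆ := hl₁.maxOver (r := fun (x : α × Vertex) (v : Vertex) =>
    StackMachine.maxOver (l x.1) fun w =>
      Vertex.weight (l x.1) fun y => y.same x.2 || (y.same v || y.same w)) h₅
  have h₇ := hl.maxOver (r := fun (a : α) (u : Vertex) => StackMachine.maxOver (l a) fun v =>
    StackMachine.maxOver (l a) fun w =>
      Vertex.weight (l a) fun y => y.same u || (y.same v || y.same w)) h₆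
  have h₈ := hl.maxOver (r := fun (a : α) (v : Vertex) =>
    Vertex.weight (l a) fun u => v.same u || v.adj u) h₁
  have h₉ := hl.maxOver (r := fun (a : α) (v : Vertex) =>
    Vertex.weight (l a) fun u => !v.adj u) h₂
  exact (h₈.fracMax h₉).fracMax (h₃.fracMax h₇)

end PolyTime

/-! ### Writing the output -/

theorem encodeNat_eq_bits (n : ℕ) : Computability.encodeNat n = n.bits := by
  have h : ∀ m : PosNum, Computability.encodePosNum m = (m : ℕ).bits := by
    intro m
    induction m with
    | one => simp [Computability.encodePosNum]
    | bit0 m ih =>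
      have := Nat.bits_append_bit (m : ℕ) false fun h => absurd h (PosNum.cast_pos m).ne'
      rw [Computability.encodePosNum, ih, ← this, Nat.bit_val]
      congr 1
      simp [PosNum.cast_bit0, two_mul]
    | bit1 m ih =>
      have := Nat.bits_append_bit (m : ℕ) true fun _ => rfl
      rw [Computability.encodePosNum, ih, ← this, Nat.bit_val]
      congr 1
      simp [PosNum.cast_bit1, two_mul]
  rw [Computability.encodeNat]
  conv_rhs => rw [← Num.to_of_nat n]
  cases (n : Num) with
  | zero => simp [Computability.encodeNum]
  | pos m => exact h m

theorem PolyTime.encodeNat {f : α → ℕ} (hf : PolyTime f) :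
    PolyTime fun a => WMISP.encodeNat (f a) := by
  refine hf.bits.recode fun a => ?_
  rw [WMISP.encodeNat, encodeNat_eq_bits]
  induction (f a).bits with
  | nil => rfl
  | cons b l ih => exact congrArg (BTree.node (.leaf b)) ih

theorem PolyTime.encode {f : α → Fraction} (hf : PolyTime f) :
    PolyTime fun a => (f a).encode :=
  ((hf.fst'.encodeNat.append (const _)).append hf.snd'.val.encodeNat).append (const _)

/-- The algorithm, applied to the input string of an instance. -/
def solve (l : List Symbol) : Fraction := Vertex.best (vertices (parse l))

theorem PolyTime.solve : PolyTime fun l => (solve l).encode :=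
  PolyTime.id.parse.vertices.best.encode

end StackMachine

/-!
## Tournaments
-/

namespace Tournament

variable {V W : Type*} {G : Tournament V}

theorem asymm {u v : V} (h : G.Adj u v) : ¬ G.Adj v u := by
  have hne : u ≠ v := fun e => G.loopless v (e ▸ h)
  exact (G.exactly_one u v hne).1 h

theorem ne_of_adj {u v : V} (h : G.Adj u v) : u ≠ v := fun e => G.loopless v (e ▸ h)

theorem adj_of_not_adj {u v : V} (hne : u ≠ v) (h : ¬ G.Adj v u) : G.Adj u v :=
  (G.exactly_one u v hne).2 h

/-- The ends of a directed path with two arcs are distinct, so they are joined by an arc;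
transitivity can fail only if this arc closes a cyclic triangle. -/
theorem isIndep_iff {S : Set V} : G.IsIndep S ↔
    ∀ u ∈ S, ∀ v ∈ S, ∀ w ∈ S, G.Adj u v → G.Adj v w → ¬ G.Adj w u := by
  refine ⟨fun h u hu v hv w hw huv hvw => asymm (h u hu v hv w hw huv hvw), fun h u hu v hv w hw
    huv hvw => adj_of_not_adj ?_ (h u hu v hv w hw huv hvw)⟩
  rintro rfl
  exact asymm huv hvw

/-- A map that preserves arcs is an induced embedding. -/
def embeddingOfHom {H : Tournament W} (f : W → V) (h : ∀ i j, H.Adj i j → G.Adj (f i) (f j)) :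
    H.Adj ↪r G.Adj where
  toFun := f
  inj' i j hij := by
    by_contra hne
    by_cases hadj : H.Adj i j
    · exact ne_of_adj (h i j hadj) hij
    · exact ne_of_adj (h j i (adj_of_not_adj (Ne.symm hne) hadj)) hij.symm
  map_rel_iff' {i j} := by
    refine ⟨fun hadj => ?_, h i j⟩
    by_contra hn
    by_cases hne : i = j
    · subst hne; exact G.loopless _ hadj
    · exact asymm (h j i (adj_of_not_adj (Ne.symm hne) hn)) hadj

theorem IsFree.false_of_hom {H : Tournament W} (hG : G.IsFree H) (f : W → V)
    (h : ∀ i j, H.Adj i j → G.Adj (f i) (f j)) : False :=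
  (show IsEmpty _ from hG).false (embeddingOfHom f h)

/-- The tournament with all arcs reversed. -/
def reverse (G : Tournament V) : Tournament V where
  Adj u v := G.Adj v u
  loopless := G.loopless
  exactly_one u v h := G.exactly_one v u h.symm

theorem reverse_adj {u v : V} : G.reverse.Adj u v ↔ G.Adj v u := Iff.rfl

theorem isIndep_reverse {S : Set V} : G.reverse.IsIndep S ↔ G.IsIndep S :=
  ⟨fun h u hu v hv w hw huv hvw => h w hw v hv u hu hvw huv,
    fun h u hu v hv w hw huv hvw => h w hw v hv u hu hvw huv⟩

theorem IsFree.reverse {H : Tournament W} (hG : G.IsFree H.reverse) : G.reverse.IsFree H :=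
  ⟨fun e => (show IsEmpty _ from hG).false (embeddingOfHom e fun _ _ h => e.map_rel_iff.2 h)⟩

theorem IsFree.of_hom {X : Type*} {H : Tournament W} {K : Tournament X} (hG : G.IsFree H)
    (f : W → X) (h : ∀ i j, H.Adj i j → K.Adj (f i) (f j)) : G.IsFree K :=
  ⟨fun e => (show IsEmpty _ from hG).false ((embeddingOfHom f h).trans e)⟩

/-! ### Tournaments with four vertices -/

/-- The arc between `x` and `y` in the direction given by a bit. -/
def arc (b : Bool) (x y : Fin 4) : Fin 4 × Fin 4 := bif b then (x, y) else (y, x)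

/-- The arcs of the tournaments `K4`, `B4`, the reverse of `B4`, and `C4`. -/
def arcs : Fin 4 → List (Fin 4 × Fin 4)
  | 0 => [(0, 1), (0, 2), (0, 3), (1, 2), (1, 3), (2, 3)]
  | 1 => [(0, 1), (2, 0), (3, 0), (1, 2), (3, 1), (3, 2)]
  | 2 => [(1, 0), (0, 2), (0, 3), (2, 1), (1, 3), (2, 3)]
  | 3 => [(0, 1), (2, 0), (0, 3), (1, 2), (3, 1), (2, 3)]

-- Six bits orient the six pairs of four labelled vertices, and all 64 cases are checked by
-- evaluation. Injectivity of the relabelling need not be demanded, as the arc lists contain no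
-- loops.
set_option synthInstance.maxHeartbeats 400000 in
set_option synthInstance.maxSize 4096 in
theorem exists_arcs_mem : ∀ b₁ b₂ b₃ b₄ b₅ b₆ : Bool, ∃ n x y z t : Fin 4,
    arc b₁ x y ∈ arcs n ∧ arc b₂ x z ∈ arcs n ∧ arc b₃ x t ∈ arcs n ∧
      arc b₄ y z ∈ arcs n ∧ arc b₅ y t ∈ arcs n ∧ arc b₆ z t ∈ arcs n := by
  decide +kernel

theorem exists_hom_of_card_eq_four [Fintype W] (H : Tournament W) (hW : Fintype.card W = 4) :
    ∃ K ∈ [K4, B4, B4.reverse, C4], ∃ f : W → Fin 4, ∀ i j, H.Adj i j → K.Adj (f i) (f j) := by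
  classical
  let e : W ≃ Fin 4 := Fintype.equivFinOfCardEq hW
  let b : Fin 4 → Fin 4 → Bool := fun i j => decide (H.Adj (e.symm i) (e.symm j))
  obtain ⟨n, x, y, z, t, h₁, h₂, h₃, h₄, h₅, h₆⟩ :=
    exists_arcs_mem (b 0 1) (b 0 2) (b 0 3) (b 1 2) (b 1 3) (b 2 3)
  have key : ∀ K : Tournament (Fin 4), (∀ i j, (i, j) ∈ arcs n → K.Adj i j) →
      ∃ f : W → Fin 4, ∀ i j, H.Adj i j → K.Adj (f i) (f j) := by
    intro K hK
    have hb : ∀ i j u v, arc (b i j) u v ∈ arcs n →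
        (H.Adj (e.symm i) (e.symm j) → K.Adj u v) ∧ (H.Adj (e.symm j) (e.symm i) → K.Adj v u) := by
      intro i j u v h
      constructor
      · intro hij
        have : b i j = true := decide_eq_true hij
        rw [this] at h
        exact hK _ _ h
      · intro hji
        have : b i j = false := decide_eq_false (asymm hji)
        rw [this] at h
        exact hK _ _ h
    refine ⟨![x, y, z, t] ∘ e, fun i j hij => ?_⟩
    obtain ⟨i, rfl⟩ := e.symm.surjective i
    obtain ⟨j, rfl⟩ := e.symm.surjective j
    simp only [Function.comp_apply, Equiv.apply_symm_apply]
    have hne : i ≠ j := fun h => ne_of_adj hij (congrArg _ h)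
    fin_cases i <;> fin_cases j <;> first
      | exact absurd rfl hne
      | exact (hb 0 1 _ _ h₁).1 hij | exact (hb 0 1 _ _ h₁).2 hij
      | exact (hb 0 2 _ _ h₂).1 hij | exact (hb 0 2 _ _ h₂).2 hij
      | exact (hb 0 3 _ _ h₃).1 hij | exact (hb 0 3 _ _ h₃).2 hij
      | exact (hb 1 2 _ _ h₄).1 hij | exact (hb 1 2 _ _ h₄).2 hij
      | exact (hb 1 3 _ _ h₅).1 hij | exact (hb 1 3 _ _ h₅).2 hij
      | exact (hb 2 3 _ _ h₆).1 hij | exact (hb 2 3 _ _ h₆).2 hij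
  fin_cases n
  · exact ⟨K4, by simp, key _ (by simp only [K4]; decide)⟩
  · exact ⟨B4, by simp, key _ fun i j h => h⟩
  · exact ⟨B4.reverse, by simp, key _ (by simp only [reverse, B4]; decide)⟩
  · exact ⟨C4, by simp, key _ fun i j h => h⟩

/-! ### Tournaments without a transitive subtournament on four vertices -/

/-- A set of at least `2 ^ k` vertices contains a transitive subtournament on `k + 1` vertices. -/
theorem exists_pairwise_adj (G : Tournament V) (k : ℕ) (S : Finset V) (hS : 2 ^ k ≤ S.card) :
    ∃ l : List V, l.length = k + 1 ∧ (∀ v ∈ l, v ∈ S) ∧ l.Pairwise G.Adj := by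
  classical
  induction k generalizing S with
  | zero =>
    obtain ⟨v, hv⟩ := Finset.card_pos.1 (by simpa using hS)
    exact ⟨[v], by simp, by simpa using hv, by simp⟩
  | succ k ih =>
    rw [pow_succ] at hS
    have hk := Nat.one_le_two_pow (n := k)
    obtain ⟨v, hv⟩ := Finset.card_pos.1 (by omega : 0 < S.card)
    have hcard := Finset.card_filter_add_card_filter_not (s := S.erase v) (fun u => G.Adj v u)
    rw [Finset.card_erase_of_mem hv] at hcard
    -- At least `2 ^ (k + 1) - 1` vertices other than `v` are split into out- and in-neighbours, so
    -- one part has at least `2 ^ k`. Accordingly `v` is put first or last.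
    by_cases hout : 2 ^ k ≤ ((S.erase v).filter fun u => G.Adj v u).card
    · obtain ⟨l, hl, hmem, hp⟩ := ih _ hout
      refine ⟨v :: l, by simp [hl], fun u hu => ?_, List.pairwise_cons.2
        ⟨fun u hu => (Finset.mem_filter.1 (hmem u hu)).2, hp⟩⟩
      rcases List.mem_cons.1 hu with rfl | hu
      · exact hv
      · exact Finset.mem_of_mem_erase (Finset.mem_filter.1 (hmem u hu)).1
    · obtain ⟨l, hl, hmem, hp⟩ := ih ((S.erase v).filter fun u => ¬ G.Adj v u) (by omega)
      refine ⟨l ++ [v], by simp [hl], fun u hu => ?_, List.pairwise_append.2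
        ⟨hp, by simp, fun u hu x hx => ?_⟩⟩
      · rcases List.mem_append.1 hu with hu | hu
        · exact Finset.mem_of_mem_erase (Finset.mem_filter.1 (hmem u hu)).1
        · rw [List.mem_singleton.1 hu]; exact hv
      · obtain ⟨h₁, h₂⟩ := Finset.mem_filter.1 (hmem u hu)
        rw [List.mem_singleton.1 hx]
        exact adj_of_not_adj (Finset.ne_of_mem_erase h₁) h₂

theorem IsFree.false_of_pairwise (hG : G.IsFree K4) {l : List V} (hl : l.length = 4)
    (h : l.Pairwise G.Adj) : False := by
  refine hG.false_of_hom (fun i => l[i]) fun i j hij => ?_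
  exact List.pairwise_iff_getElem.1 h i j _ _ hij

theorem IsFree.card_lt_eight [Fintype V] (hG : G.IsFree K4) : Fintype.card V < 8 := by
  by_contra h
  obtain ⟨l, hl, -, hp⟩ := G.exists_pairwise_adj 3 Finset.univ (by rw [Finset.card_univ]; omega)
  exact hG.false_of_pairwise hl hp

/-- Every finite tournament is isomorphic to one on some `Fin n`, so counting labelled tournaments
suffices: here `n < 8`, and each `n` admits finitely many arc relations. -/
theorem finite_isFree_K4 : {T : (n : ℕ) × Tournament (Fin n) | T.2.IsFree K4}.Finite := by
  have hfin : ∀ n, Finite (Tournament (Fin n)) := fun n => by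
    refine Finite.of_injective (β := Fin n → Fin n → Prop) (fun T => T.Adj) ?_
    rintro ⟨⟨A⟩, _, _⟩ ⟨⟨B⟩, _, _⟩ h
    cases h
    rfl
  refine (Set.finite_range fun x : (n : Fin 8) × Tournament (Fin n) =>
    (⟨x.1, x.2⟩ : (n : ℕ) × Tournament (Fin n))).subset ?_
  rintro ⟨n, T⟩ hT
  have := IsFree.card_lt_eight hT
  rw [Fintype.card_fin] at this
  exact ⟨⟨⟨n, this⟩, T⟩, rfl⟩

/-- An independent set has a source. -/
theorem IsIndep.exists_source {S : Finset V} (hS : G.IsIndep (S : Set V)) (hne : S.Nonempty) :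
    ∃ v ∈ S, ∀ u ∈ S, u = v ∨ G.Adj v u := by
  induction hne using Finset.Nonempty.cons_induction with
  | singleton a => exact ⟨a, by simp, by simp⟩
  | cons a S ha hne ih =>
    obtain ⟨v, hv, h⟩ := ih fun u hu v hv w hw => hS u (by simp [show u ∈ S from hu])
      v (by simp [show v ∈ S from hv]) w (by simp [show w ∈ S from hw])
    by_cases hva : G.Adj v a
    · refine ⟨v, by simp [hv], fun u hu => ?_⟩
      rcases Finset.mem_cons.1 hu with rfl | hu
      · exact .inr hva
      · exact h u hu
    · have hav := adj_of_not_adj (by rintro rfl; exact ha hv) hva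
      refine ⟨a, by simp, fun u hu => ?_⟩
      rcases Finset.mem_cons.1 hu with rfl | hu
      · exact .inl rfl
      · rcases h u hu with rfl | hvu
        · exact .inr hav
        · exact .inr (hS a (by simp) v (by simp [hv]) u (by simp [hu]) hav hvu)

theorem IsIndep.exists_pairwise_adj {S : Finset V} (hS : G.IsIndep (S : Set V)) :
    ∃ l : List V, l.length = S.card ∧ (∀ v ∈ l, v ∈ S) ∧ l.Pairwise G.Adj := by
  classical
  induction hn : S.card generalizing S with
  | zero => exact ⟨[], by simp⟩
  | succ n ih =>
    obtain ⟨v, hv, h⟩ := hS.exists_source (Finset.card_pos.1 (by omega))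
    obtain ⟨l, hl, hmem, hp⟩ := ih (S := S.erase v)
      (fun a ha b hb c hc => hS a (Finset.mem_of_mem_erase ha) b (Finset.mem_of_mem_erase hb) c
        (Finset.mem_of_mem_erase hc)) (by rw [Finset.card_erase_of_mem hv]; omega)
    refine ⟨v :: l, by simp [hl], fun u hu => ?_, List.pairwise_cons.2 ⟨fun u hu => ?_, hp⟩⟩
    · rcases List.mem_cons.1 hu with rfl | hu
      · exact hv
      · exact Finset.mem_of_mem_erase (hmem u hu)
    · exact (h u (Finset.mem_of_mem_erase (hmem u hu))).resolve_left
        (Finset.ne_of_mem_erase (hmem u hu))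

theorem IsFree.card_lt_four_of_isIndep (hG : G.IsFree K4) {S : Finset V}
    (hS : G.IsIndep (S : Set V)) : S.card < 4 := by
  by_contra h
  obtain ⟨l, hl, -, hp⟩ := hS.exists_pairwise_adj
  exact hG.false_of_pairwise (l := l.take 4) (by simp; omega)
    (hp.sublist (List.take_sublist 4 l))

/-! ### Tournaments in which out-neighbourhoods are transitive -/

theorem mem_closedOut [Fintype V] {u v : V} : u ∈ G.closedOut v ↔ u = v ∨ G.Adj v u := by
  classical
  simp [closedOut]

/-- No out-neighbour of `v` has an arc to `v`, so a cyclic triangle in the set avoids `v` and forms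
a copy of `B4` together with it. -/
theorem IsFree.isIndep_closedOut [Fintype V] (hG : G.IsFree B4) (v : V) :
    G.IsIndep (G.closedOut v : Set V) := by
  rw [isIndep_iff]
  intro a ha b hb c hc hab hbc hca
  simp only [Finset.mem_coe, mem_closedOut] at ha hb hc
  have aux : ∀ a b c, (b = v ∨ G.Adj v b) → (c = v ∨ G.Adj v c) → G.Adj a b → G.Adj b c →
      G.Adj c a → a ≠ v := by
    rintro a b c hb hc hab hbc hca rfl
    rcases hc with rfl | hc
    · exact G.loopless _ hca
    · exact asymm hca hc
  have ha' := ha.resolve_left (aux a b c hb hc hab hbc hca)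
  have hb' := hb.resolve_left (aux b c a hc ha hbc hca hab)
  have hc' := hc.resolve_left (aux c a b ha hb hca hab hbc)
  refine hG.false_of_hom ![a, b, c, v] fun i j hij => ?_
  simp only [B4, List.mem_cons, Prod.mk.injEq, List.not_mem_nil, or_false] at hij
  rcases hij with ⟨rfl, rfl⟩ | ⟨rfl, rfl⟩ | ⟨rfl, rfl⟩ | ⟨rfl, rfl⟩ | ⟨rfl, rfl⟩ | ⟨rfl, rfl⟩ <;>
    assumption

/-- The closed out-neighbourhood of a source of `S` contains `S`, and weights are nonnegative. -/
theorem IsIndep.sum_le_closedOut [Fintype V] {S : Finset V} (hS : G.IsIndep (S : Set V))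
    (hne : S.Nonempty) {w : V → ℚ} (hw : ∀ v, 0 ≤ w v) :
    ∃ v, ∑ u ∈ S, w u ≤ ∑ u ∈ G.closedOut v, w u := by
  obtain ⟨v, -, h⟩ := hS.exists_source hne
  exact ⟨v, Finset.sum_le_sum_of_subset_of_nonneg (fun u hu => mem_closedOut.2 (h u hu))
    fun u _ _ => hw u⟩

theorem IsFree.exists_closedOut_optimal [Fintype V] [Nonempty V] (hG : G.IsFree B4) {w : V → ℚ}
    (hw : ∀ v, 0 ≤ w v) : ∃ v, G.IsIndep (G.closedOut v : Set V) ∧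
      ∀ S : Finset V, G.IsIndep (S : Set V) → ∑ u ∈ S, w u ≤ ∑ u ∈ G.closedOut v, w u := by
  obtain ⟨v, hv⟩ := Finite.exists_max fun v => ∑ u ∈ G.closedOut v, w u
  refine ⟨v, hG.isIndep_closedOut v, fun S hS => ?_⟩
  rcases S.eq_empty_or_nonempty with rfl | hne
  · rw [Finset.sum_empty]; exact Finset.sum_nonneg fun u _ => hw u
  · obtain ⟨u, hu⟩ := hS.sum_le_closedOut hne hw
    exact hu.trans (hv u)

/-! ### Tournaments without a strong subtournament on four vertices -/

section C4

theorem IsFree.false_of_C4 (hG : G.IsFree C4) {a b c x : V} (hab : G.Adj a b) (hbc : G.Adj b c)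
    (hca : G.Adj c a) (hax : G.Adj a x) (hxb : G.Adj x b) (hcx : G.Adj c x) : False := by
  refine hG.false_of_hom ![a, b, c, x] fun i j hij => ?_
  simp only [C4, List.mem_cons, Prod.mk.injEq, List.not_mem_nil, or_false] at hij
  rcases hij with ⟨rfl, rfl⟩ | ⟨rfl, rfl⟩ | ⟨rfl, rfl⟩ | ⟨rfl, rfl⟩ | ⟨rfl, rfl⟩ | ⟨rfl, rfl⟩ <;>
    assumption

variable (hG : G.IsFree C4) {a b c : V} (hab : G.Adj a b) (hbc : G.Adj b c) (hca : G.Adj c a)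
include hG hab hbc hca

/-- A vertex dominated by one vertex of a cyclic triangle is dominated by all of them. -/
theorem IsFree.adj_of_adj_triangle {x : V} (hax : G.Adj a x) (hxb : x ≠ b) :
    G.Adj b x ∧ G.Adj c x := by
  have hxc : x ≠ c := by rintro rfl; exact asymm hax hca
  by_cases hbx : G.Adj b x
  · refine ⟨hbx, adj_of_not_adj hxc.symm fun hxc' => ?_⟩
    exact hG.false_of_C4 hbc hca hab hbx hxc' hax
  · have hxb' := adj_of_not_adj hxb hbx
    by_cases hcx : G.Adj c x
    · exact (hG.false_of_C4 hab hbc hca hax hxb' hcx).elim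
    · have hxc' := adj_of_not_adj hxc hcx
      -- Here `x`, `c`, `a` is another cyclic triangle, and `b` is dominated by `x` and `a` but
      -- dominates `c`.
      exact (hG.false_of_C4 hxc' hca hax hxb' hbc hab).elim

/-- A vertex is contained in at most one cyclic triangle. -/
theorem IsFree.triangle_unique {x y : V} (hax : G.Adj a x) (hxy : G.Adj x y) (hya : G.Adj y a) :
    x = b ∧ y = c := by
  -- Otherwise `a` dominates `x`, so the triangle through `b` dominates `x`; likewise `a` dominates
  -- `b`, so the triangle through `x` dominates `b`. Both arcs between `b` and `x` would be present.
  have hx : x = b := by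
    by_contra hxb
    obtain ⟨hbx, hcx⟩ := hG.adj_of_adj_triangle hab hbc hca hax hxb
    have := (hG.adj_of_adj_triangle hax hxy hya hab (Ne.symm hxb)).1
    exact asymm hbx this
  subst hx
  refine ⟨rfl, ?_⟩
  by_contra hyc
  exact asymm hya (hG.adj_of_adj_triangle hbc hca hab hxy hyc).2

/-- A walk that leaves the triangle enters the set of vertices other than `b` that `a` dominates. No
walk leaves this set: an arc from it back to `a` would create a second cyclic triangle through `a`,
and `b` dominates all of it. So the walk never returns. -/
theorem IsFree.strongComponent_of_triangle : G.strongComponent a = {a, b, c} := by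
  have hclosed : ∀ x y, Relation.ReflTransGen G.Adj x y → G.Adj a x → x ≠ b →
      G.Adj a y ∧ y ≠ b := by
    intro x y hxy hax hxb
    induction hxy with
    | refl => exact ⟨hax, hxb⟩
    | @tail y z _ hyz ih =>
      obtain ⟨hay, hyb⟩ := ih
      obtain ⟨hby, -⟩ := hG.adj_of_adj_triangle hab hbc hca hay hyb
      refine ⟨adj_of_not_adj ?_ fun hza => hyb
        (hG.triangle_unique hab hbc hca hay hyz hza).1, ?_⟩
      · rintro rfl; exact asymm hay hyz
      · rintro rfl; exact asymm hby hyz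
  have hreach : ∀ y, Relation.ReflTransGen G.Adj a y →
      (y = a ∨ y = b ∨ y = c) ∨ (G.Adj a y ∧ y ≠ b) := by
    intro y hy
    induction hy with
    | refl => simp
    | @tail y z _ hyz ih =>
      by_cases hz : z = a ∨ z = b ∨ z = c
      · exact .inl hz
      push Not at hz
      right
      rcases ih with (rfl | rfl | rfl) | ⟨hay, hyb⟩
      · exact ⟨hyz, hz.2.1⟩
      · exact ⟨(hG.adj_of_adj_triangle hbc hca hab hyz hz.2.2).2, hz.2.1⟩
      · exact ⟨(hG.adj_of_adj_triangle hca hab hbc hyz hz.1).1, hz.2.1⟩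
      · exact hclosed y z (.single hyz) hay hyb
  ext x
  constructor
  · rintro ⟨hax, hxa⟩
    rcases hreach x hax with h | ⟨h₁, h₂⟩
    · simpa using h
    · exact absurd (hclosed x a hxa h₁ h₂).1 (G.loopless a)
  · rintro (rfl | rfl | rfl)
    · exact ⟨.refl, .refl⟩
    · exact ⟨.single hab, (Relation.ReflTransGen.single hbc).tail hca⟩
    · exact ⟨(Relation.ReflTransGen.single hab).tail hbc, .single hca⟩

end C4

/-- If `v` lies in no cyclic triangle, no arc leaves its out-neighbourhood, so a walk that leaves
`v` cannot come back. -/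
theorem strongComponent_of_forall_not_triangle {v : V}
    (h : ∀ x y, G.Adj v x → G.Adj x y → ¬ G.Adj y v) : G.strongComponent v = {v} := by
  have hclosed : ∀ x y, Relation.ReflTransGen G.Adj x y → G.Adj v x → G.Adj v y := by
    intro x y hxy hvx
    induction hxy with
    | refl => exact hvx
    | @tail y z _ hyz ih =>
      refine adj_of_not_adj ?_ (h y z ih hyz)
      rintro rfl
      exact asymm ih hyz
  ext x
  refine ⟨fun ⟨hvx, hxv⟩ => ?_, ?_⟩
  · rcases Relation.ReflTransGen.cases_head hvx with rfl | ⟨y, hvy, hyx⟩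
    · rfl
    · exact absurd (hclosed y v (hyx.trans hxv) hvy) (G.loopless v)
  · rintro rfl
    exact ⟨.refl, .refl⟩

theorem IsFree.ncard_strongComponent (hG : G.IsFree C4) (v : V) :
    (G.strongComponent v).ncard = 1 ∨ (G.strongComponent v).ncard = 3 := by
  by_cases h : ∃ x y, G.Adj v x ∧ G.Adj x y ∧ G.Adj y v
  · obtain ⟨x, y, hvx, hxy, hyv⟩ := h
    right
    rw [hG.strongComponent_of_triangle hvx hxy hyv]
    exact Set.ncard_eq_three.2 ⟨v, x, y, ne_of_adj hvx, (ne_of_adj hyv).symm, ne_of_adj hxy, rfl⟩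
  · left
    push Not at h
    rw [strongComponent_of_forall_not_triangle h, Set.ncard_singleton]

/-- `v` is not the least vertex of any cyclic triangle. -/
def NotLeast (G : Tournament V) (r : V → V → Prop) (v : V) : Prop :=
  ∀ a b, G.Adj v a → G.Adj a b → G.Adj b v → r v a → ¬ r v b

/-- Every cyclic triangle has a least vertex, and that vertex is missing from the set. No freeness
is needed for this. -/
theorem isIndep_notLeast (G : Tournament V) (r : V → V → Prop) [IsStrictTotalOrder V r] :
    G.IsIndep {v | G.NotLeast r v} := by
  rw [isIndep_iff]
  intro a ha b hb c hc hab hbc hca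
  have hba := ha b c hab hbc hca
  have hcb := hb c a hbc hca hab
  have hac := hc a b hca hab hbc
  have tri : ∀ {x y : V}, G.Adj x y → r x y ∨ r y x := fun {x y} h =>
    (trichotomous_of r x y).imp_right (Or.resolve_left · (ne_of_adj h))
  rcases tri hab with h | h
  · rcases tri hca with h' | h'
    · exact hac h' (_root_.trans h' h)
    · exact hba h h'
  · rcases tri hbc with h' | h'
    · exact hcb h' h
    · exact hac (_root_.trans h' h) h'

-- Exchange argument. A vertex `v` of `S` outside the set `T` is least in its only cyclic triangle,
-- and `S` misses another vertex of that triangle. This vertex is no lighter than `v`, and it lies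
-- in `T` because its only triangle has the smaller vertex `v`. Replacing `v` by it is injective,
-- since triangles are disjoint and each has one least vertex.
open Classical in
theorem IsFree.sum_le_notLeast [Fintype V] (hG : G.IsFree C4) {w : V → ℚ} (hw : ∀ v, 0 ≤ w v)
    (r : V → V → Prop) [IsStrictTotalOrder V r] (hr : ∀ u v, r u v → w u ≤ w v) {S : Finset V}
    (hS : G.IsIndep (S : Set V)) : ∑ v ∈ S, w v ≤ ∑ v with G.NotLeast r v, w v := by
  let T : Finset V := {v | G.NotLeast r v}
  have hmem : ∀ v, v ∈ T ↔ G.NotLeast r v := fun v => by simp [T]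
  -- The third vertex `t` and the comparison `r v t` are recorded in order to recover `v` from `u`
  -- as the least vertex of the triangle; the replacement `u` may follow or precede `v` on the
  -- cycle.
  have hex : ∀ v ∈ S \ T, ∃ u ∈ T \ S, r v u ∧ ∃ t, (G.Adj v u ∧ G.Adj u t ∧ G.Adj t v ∧ r v t) ∨
      (G.Adj v t ∧ G.Adj t u ∧ G.Adj u v ∧ r v t) := by
    intro v hv
    obtain ⟨hvS, hvT⟩ := Finset.mem_sdiff.1 hv
    rw [hmem, NotLeast] at hvT
    push Not at hvT
    obtain ⟨a, b, hva, hab, hbv, hra, hrb⟩ := hvT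
    by_cases haS : a ∈ S
    · refine ⟨b, Finset.mem_sdiff.2 ⟨(hmem b).2 fun x y hbx hxy hyb hrx => ?_, fun hbS =>
        isIndep_iff.1 hS v hvS a haS b hbS hva hab hbv⟩, hrb, a, .inr ⟨hva, hab, hbv, hra⟩⟩
      obtain ⟨rfl, rfl⟩ := hG.triangle_unique hbv hva hab hbx hxy hyb
      exact absurd hrx (asymm_of r hrb)
    · refine ⟨a, Finset.mem_sdiff.2 ⟨(hmem a).2 fun x y hax hxy hya _ hry => ?_, haS⟩, hra, b,
        .inl ⟨hva, hab, hbv, hrb⟩⟩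
      obtain ⟨rfl, rfl⟩ := hG.triangle_unique hab hbv hva hax hxy hya
      exact asymm_of r hra hry
  choose! φ hφ hrφ t ht using hex
  have hinj : Set.InjOn φ (S \ T : Finset V) := by
    -- Both triangles pass through `u` and hence coincide. If `v` and `v'` were different vertices
    -- of it, each would be below the other.
    have key : ∀ u v v' s s' : V, (G.Adj v u ∧ G.Adj u s ∧ G.Adj s v ∧ r v s) →
        ((G.Adj v' u ∧ G.Adj u s' ∧ G.Adj s' v' ∧ r v' s') ∨
          (G.Adj v' s' ∧ G.Adj s' u ∧ G.Adj u v' ∧ r v' s')) → v = v' := by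
      rintro u v v' s s' ⟨h₁, h₂, h₃, h₄⟩ (⟨h₅, h₆, h₇, h₈⟩ | ⟨h₅, h₆, h₇, h₈⟩)
      · exact ((hG.triangle_unique h₂ h₃ h₁ h₆ h₇ h₅).2).symm
      · obtain ⟨rfl, rfl⟩ := hG.triangle_unique h₂ h₃ h₁ h₇ h₅ h₆
        exact absurd h₄ (asymm_of r h₈)
    intro v hv v' hv' heq
    have h := ht v hv
    have h' := ht v' hv'
    rw [← heq] at h'
    rcases h with h | h
    · exact key _ _ _ _ _ h h'
    · rcases h' with h' | h'
      · exact (key _ _ _ _ _ h' (.inr h)).symm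
      · exact (hG.triangle_unique h.2.2.1 h.1 h.2.1 h'.2.2.1 h'.1 h'.2.1).1.symm
  have h₁ : ∑ v ∈ S \ T, w v ≤ ∑ v ∈ T \ S, w v :=
    calc ∑ v ∈ S \ T, w v ≤ ∑ v ∈ S \ T, w (φ v) :=
          Finset.sum_le_sum fun v hv => hr _ _ (hrφ v hv)
      _ = ∑ v ∈ (S \ T).image φ, w v := (Finset.sum_image hinj).symm
      _ ≤ ∑ v ∈ T \ S, w v := Finset.sum_le_sum_of_subset_of_nonneg
          (fun u hu => by
            obtain ⟨v, hv, rfl⟩ := Finset.mem_image.1 hu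
            exact hφ v hv) fun v _ _ => hw v
  exact Finset.sum_sdiff_le_sum_sdiff.1 h₁

end Tournament

/-!
## Correctness of the algorithm
-/

namespace StackMachine

open WMISP Tournament

namespace Vertex

variable (I : Instance)

open Classical in
/-- The row of the adjacency matrix of a vertex followed by the numerator of its weight, and the
denominator of its weight. -/
noncomputable def rawData (v : Fin I.n) : List Bool × List Bool :=
  ((List.finRange I.n).map (fun u => decide (I.G.Adj v u)) ++ (I.w v).1.bits, ((I.w v).2 : ℕ).bits)

noncomputable def ofInstance (v : Fin I.n) : Vertex :=
  vertexOf I.n (List.replicate v false) (rawData I v)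

noncomputable def listOfInstance : List Vertex :=
  ((List.finRange I.n).map (ofInstance I)).reverse

theorem parse_encode : parse I.encode = (List.finRange I.n).map (rawData I) := by
  have h : I.encode = ((List.finRange I.n).map (rawData I)).flatMap
      fun y => y.1.map some ++ [none] ++ y.2.map some ++ [none] := by
    rw [Instance.encode, List.flatMap_map]
    congr 1
    funext v
    simp [rawData, Fraction.encode, encodeNat, encodeNat_eq_bits]
  rw [parse, h, foldr_parseStep]

theorem vertices_parse_encode : vertices (parse I.encode) = listOfInstance I := by
  rw [parse_encode, vertices, foldl_vertexStep, listOfInstance]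
  refine congrArg List.reverse (List.ext_getElem (by simp) fun i h₁ h₂ => ?_)
  simp [ofInstance]

variable {I}

theorem mem_listOfInstance {x : Vertex} : x ∈ listOfInstance I ↔ ∃ v, ofInstance I v = x := by
  simp [listOfInstance]

theorem weight_ofInstance (v : Fin I.n) : (ofInstance I v).2.2 = I.w v := by
  have h : ((List.finRange I.n).map fun u =>
      @decide (I.G.Adj v u) (Classical.propDecidable _)).length = I.n := by simp
  refine Prod.ext ?_ ?_
  · simp only [ofInstance, vertexOf, rawData]
    rw [List.drop_append_of_le_length h.ge, List.drop_of_length_le h.le, List.nil_append,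
      natOfBits_bits]
  · simp [ofInstance, vertexOf, rawData, natOfBits_bits]

theorem adj_ofInstance (u v : Fin I.n) :
    adj (ofInstance I u) (ofInstance I v) = true ↔ I.G.Adj u v := by
  have h : (v : ℕ) < ((List.finRange I.n).map fun w =>
      @decide (I.G.Adj u w) (Classical.propDecidable _)).length := by simp
  simp only [adj, ofInstance, vertexOf, rawData, List.length_replicate]
  rw [List.headD_eq_head?_getD, List.head?_drop, List.getElem?_append_left h,
    List.getElem?_eq_getElem h]
  simp

theorem before_ofInstance (u v : Fin I.n) :
    before (ofInstance I u) (ofInstance I v) = true ↔ u < v := by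
  simp [before, ofInstance, vertexOf, Nat.sub_eq_zero_iff_le]

theorem same_ofInstance (u v : Fin I.n) :
    same (ofInstance I u) (ofInstance I v) = true ↔ u = v := by
  rw [same, Bool.and_eq_true, Bool.not_eq_true', Bool.not_eq_true', ← Bool.not_eq_true,
    ← Bool.not_eq_true, before_ofInstance, before_ofInstance, not_lt, not_lt]
  exact ⟨fun h => le_antisymm h.2 h.1, fun h => ⟨h.ge, h.le⟩⟩

theorem cyclic_ofInstance (u v w : Fin I.n) :
    cyclic (ofInstance I u) (ofInstance I v) (ofInstance I w) = true ↔
      I.G.Adj u v ∧ I.G.Adj v w ∧ I.G.Adj w u := by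
  rw [cyclic, Bool.and_eq_true, Bool.and_eq_true, adj_ofInstance, adj_ofInstance, adj_ofInstance]

/-- The order by weight and, in case of a tie, index. -/
def Lighter (I : Instance) (u v : Fin I.n) : Prop :=
  (I.w u).value ≤ (I.w v).value ∧ ((I.w u).value < (I.w v).value ∨ u < v)

/-- The tie-break by index makes the least vertex of a triangle unique even if weights coincide. -/
instance : IsStrictTotalOrder (Fin I.n) (Lighter I) where
  trichotomous u v h₁ h₂ := by
    simp only [Lighter, not_and_or, not_or, not_le, not_lt] at h₁ h₂
    rcases lt_trichotomy (I.w u).value (I.w v).value with h | h | h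
    · rcases h₁ with h' | h'
      · linarith
      · linarith [h'.1]
    · rcases h₁ with h' | h'
      · linarith
      · rcases h₂ with h'' | h''
        · linarith
        · exact le_antisymm h''.2 h'.2
    · rcases h₂ with h' | h'
      · linarith
      · linarith [h'.1]
  irrefl u h := by
    rcases h.2 with h | h
    · exact lt_irrefl _ h
    · exact lt_irrefl _ h
  trans u v w h₁ h₂ := by
    refine ⟨h₁.1.trans h₂.1, ?_⟩
    rcases h₁.2 with h | h
    · exact .inl (h.trans_le h₂.1)
    · rcases h₂.2 with h' | h'
      · exact .inl (h₁.1.trans_lt h')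
      · exact .inr (h.trans h')

theorem lighter_ofInstance (u v : Fin I.n) :
    lighter (ofInstance I u) (ofInstance I v) = true ↔ Lighter I u v := by
  rw [lighter, Bool.and_eq_true, Bool.or_eq_true, Bool.not_eq_true', ← Bool.not_eq_true,
    weight_ofInstance, weight_ofInstance, fracLe_iff, fracLe_iff, before_ofInstance, not_le, Lighter]

theorem kept_ofInstance (u : Fin I.n) :
    kept (listOfInstance I) (ofInstance I u) = true ↔ I.G.NotLeast (Lighter I) u := by
  rw [kept, Bool.not_eq_true', ← Bool.not_eq_true]
  simp only [List.any_eq_true, mem_listOfInstance, exists_exists_eq_and, Bool.and_eq_true,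
    cyclic_ofInstance, lighter_ofInstance, NotLeast, not_exists]
  exact forall₂_congr fun a b => by tauto

theorem isIndep_iff_any₃ (p : Vertex → Bool) :
    I.G.IsIndep {v | p (ofInstance I v) = true} ↔ any₃ (listOfInstance I)
      (fun u v w => p u && (p v && (p w && cyclic u v w))) = false := by
  rw [isIndep_iff, ← Bool.not_eq_true]
  simp only [any₃, List.any_eq_true, mem_listOfInstance, exists_exists_eq_and, Bool.and_eq_true,
    cyclic_ofInstance, Set.mem_ofPred_eq, not_exists]
  exact ⟨fun h u v w ⟨hu, hv, hw, h₁, h₂, h₃⟩ => h u hu v hv w hw h₁ h₂ h₃,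
    fun h u hu v hv w hw h₁ h₂ h₃ => h u v w ⟨hu, hv, hw, h₁, h₂, h₃⟩⟩

theorem value_weight {p : Vertex → Bool}
    (h : I.G.IsIndep {v | p (ofInstance I v) = true}) :
    (weight (listOfInstance I) p).value =
      ∑ v with p (ofInstance I v) = true, (I.w v).value := by
  rw [isIndep_iff_any₃] at h
  rw [weight, h, cond_false, value_sumOver, listOfInstance, List.map_reverse, List.sum_reverse,
    List.map_map, ← Fin.sum_univ_def, Finset.sum_filter]
  refine Finset.sum_congr rfl fun v _ => ?_
  rw [Function.comp_apply]
  cases p (ofInstance I v) <;> simp [weight_ofInstance]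

/-- `q` is the weight of an independent set. -/
def IsWeight (I : Instance) (q : ℚ) : Prop :=
  ∃ S : Finset (Fin I.n), I.G.IsIndep (S : Set (Fin I.n)) ∧ q = ∑ v ∈ S, (I.w v).value

theorem isWeight_zero : IsWeight I 0 := ⟨∅, by simp [IsIndep], by simp⟩

/-- A candidate that is not independent scores 0, the weight of the empty set. Thus the output is
sound for every tournament, and freeness matters only for optimality. -/
theorem isWeight_weight (p : Vertex → Bool) : IsWeight I (weight (listOfInstance I) p).value := by
  by_cases h : I.G.IsIndep {v | p (ofInstance I v) = true}
  · exact ⟨_, by simpa using h, value_weight h⟩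
  · rw [isIndep_iff_any₃, Bool.not_eq_false] at h
    rw [weight, h, cond_true, value_zero]
    exact isWeight_zero

theorem isWeight_maxOver {r : Vertex → Fraction} (h : ∀ x, IsWeight I (r x).value) :
    IsWeight I (maxOver (listOfInstance I) r).value :=
  value_maxOver_mem _ _ isWeight_zero fun x _ => h x

theorem isWeight_fracMax {x y : Fraction} (hx : IsWeight I x.value) (hy : IsWeight I y.value) :
    IsWeight I (fracMax x y).value := by
  rw [value_fracMax]
  rcases max_choice x.value y.value with h | h <;> rw [h] <;> assumption

theorem isWeight_best : IsWeight I (best (listOfInstance I)).value :=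
  isWeight_fracMax
    (isWeight_fracMax (isWeight_maxOver fun _ => isWeight_weight _)
      (isWeight_maxOver fun _ => isWeight_weight _))
    (isWeight_fracMax (isWeight_weight _)
      (isWeight_maxOver fun _ => isWeight_maxOver fun _ => isWeight_maxOver fun _ =>
        isWeight_weight _))

theorem le_value_weight {S T : Finset (Fin I.n)} {p : Vertex → Bool}
    (hST : ∑ v ∈ S, (I.w v).value ≤ ∑ v ∈ T, (I.w v).value)
    (hT : I.G.IsIndep (T : Set (Fin I.n))) (hp : ∀ v, p (ofInstance I v) = true ↔ v ∈ T) :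
    ∑ v ∈ S, (I.w v).value ≤ (weight (listOfInstance I) p).value := by
  have h₁ : {v | p (ofInstance I v) = true} = (T : Set (Fin I.n)) := Set.ext hp
  have h₂ : Finset.univ.filter (fun v => p (ofInstance I v) = true) = T := by
    ext v; simpa using hp v
  rw [value_weight (h₁ ▸ hT), h₂]
  exact hST

theorem le_value_maxOver {q : ℚ} {r : Vertex → Fraction} (v : Fin I.n)
    (h : q ≤ (r (ofInstance I v)).value) : q ≤ (maxOver (listOfInstance I) r).value :=
  h.trans (value_le_maxOver r (mem_listOfInstance.2 ⟨v, rfl⟩))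

variable {S : Finset (Fin I.n)} (hS : I.G.IsIndep (S : Set (Fin I.n)))
include hS

theorem le_value_best_of_isFree_B4 (hne : S.Nonempty) (hG : I.G.IsFree B4) :
    ∑ v ∈ S, (I.w v).value ≤ (best (listOfInstance I)).value := by
  obtain ⟨v, hv⟩ := hS.sum_le_closedOut hne fun v => value_nonneg (I.w v)
  rw [best, value_fracMax, value_fracMax]
  refine le_max_of_le_left (le_max_of_le_left (le_value_maxOver v
    (le_value_weight hv (hG.isIndep_closedOut v) fun u => ?_)))
  rw [Bool.or_eq_true, same_ofInstance, adj_ofInstance, mem_closedOut, eq_comm]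

/-- The vertices not dominated by `v` form its closed in-neighbourhood, which is the closed
out-neighbourhood in the reversed tournament. -/
theorem le_value_best_of_isFree_reverse_B4 (hne : S.Nonempty) (hG : I.G.IsFree B4.reverse) :
    ∑ v ∈ S, (I.w v).value ≤ (best (listOfInstance I)).value := by
  obtain ⟨v, hv⟩ := (isIndep_reverse.2 hS).sum_le_closedOut hne fun v => value_nonneg (I.w v)
  rw [best, value_fracMax, value_fracMax]
  refine le_max_of_le_left (le_max_of_le_right (le_value_maxOver v
    (le_value_weight hv (isIndep_reverse.1 (hG.reverse.isIndep_closedOut v)) fun u => ?_)))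
  rw [Bool.not_eq_true', ← Bool.not_eq_true, adj_ofInstance, mem_closedOut, reverse_adj]
  by_cases huv : u = v
  · subst huv; simp [I.G.loopless]
  · rw [← I.G.exactly_one u v huv, or_iff_right huv]

theorem le_value_best_of_isFree_C4 (hG : I.G.IsFree C4) :
    ∑ v ∈ S, (I.w v).value ≤ (best (listOfInstance I)).value := by
  classical
  have h := hG.sum_le_notLeast (fun v => value_nonneg (I.w v)) (Lighter I) (fun u v h => h.1) hS
  rw [best, value_fracMax, value_fracMax, value_fracMax]
  refine le_max_of_le_right (le_max_of_le_left ?_)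
  refine le_value_weight (p := kept (listOfInstance I)) h ?_ fun u => ?_
  · simpa using isIndep_notLeast I.G (Lighter I)
  · rw [kept_ofInstance]; simp

theorem le_value_best_of_isFree_K4 (hne : S.Nonempty) (hG : I.G.IsFree K4) :
    ∑ v ∈ S, (I.w v).value ≤ (best (listOfInstance I)).value := by
  have hcard : S.card < 4 := hG.card_lt_four_of_isIndep hS
  -- Repetitions are allowed, so triples of vertices also cover sets of one or two vertices.
  have habc : ∃ a b c, ∀ x, x ∈ S ↔ x = a ∨ x = b ∨ x = c := by
    have := hne.card_pos
    interval_cases h : S.card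
    · obtain ⟨a, rfl⟩ := Finset.card_eq_one.1 h
      exact ⟨a, a, a, by simp⟩
    · obtain ⟨a, b, -, rfl⟩ := Finset.card_eq_two.1 h
      exact ⟨a, b, b, by simp⟩
    · obtain ⟨a, b, c, -, -, -, rfl⟩ := Finset.card_eq_three.1 h
      exact ⟨a, b, c, by simp⟩
  obtain ⟨a, b, c, habc⟩ := habc
  rw [best, value_fracMax, value_fracMax, value_fracMax]
  refine le_max_of_le_right (le_max_of_le_right ?_)
  refine le_value_maxOver (r := fun u : Vertex => _) a ?_
  refine le_value_maxOver (r := fun v : Vertex => _) b ?_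
  refine le_value_maxOver (r := fun w : Vertex => _) c ?_
  refine le_value_weight le_rfl hS fun x => ?_
  rw [Bool.or_eq_true, Bool.or_eq_true, same_ofInstance, same_ofInstance, same_ofInstance, habc]

end Vertex

open Vertex in
theorem isMaxWeight_solve {W : Type*} [Fintype W] {H : Tournament W} (hW : Fintype.card W = 4)
    (I : Instance) (hI : I.G.IsFree H) : I.IsMaxWeight (solve I.encode).value := by
  rw [solve, vertices_parse_encode]
  refine ⟨isWeight_best, ?_⟩
  rintro _ ⟨S, hS, rfl⟩
  -- The empty set is treated apart because the instance may have no vertices, and then no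
  -- neighbourhood or triple exists.
  rcases S.eq_empty_or_nonempty with rfl | hne
  · rw [Finset.sum_empty]; exact value_nonneg _
  obtain ⟨K, hK, f, hf⟩ := exists_hom_of_card_eq_four H hW
  have hG := hI.of_hom f hf
  simp only [List.mem_cons, List.not_mem_nil, or_false] at hK
  rcases hK with rfl | rfl | rfl | rfl
  · exact le_value_best_of_isFree_K4 hS hne hG
  · exact le_value_best_of_isFree_B4 hS hne hG
  · exact le_value_best_of_isFree_reverse_B4 hS hne hG
  · exact le_value_best_of_isFree_C4 hS hG

theorem solvableInPolyTime {W : Type*} [Fintype W] {H : Tournament W}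
    (hW : Fintype.card W = 4) : SolvableInPolyTime fun I => I.G.IsFree H :=
  ⟨fun I => solve I.1.encode, fun I => isMaxWeight_solve hW I.1 I.2,
    PolyTime.solve.computableInPolyTime fun _ => rfl⟩

end StackMachine

theorem theorem1p2 :
    -- the problem on `H`-free tournaments is solvable in polynomial time if `H` has 4 vertices
    (∀ (W : Type*) [Fintype W] (H : Tournament W), Fintype.card W = 4 →
      WMISP.SolvableInPolyTime (fun I => I.G.IsFree H)) ∧
    -- up to isomorphism there are only finitely many `K4`-free tournaments
    {T : (n : ℕ) × Tournament (Fin n) | T.2.IsFree Tournament.K4}.Finite ∧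
    -- in a `B4`-free tournament some closed out-neighbourhood is an optimal independent set
    (∀ (V : Type*) [Fintype V] [Nonempty V] (G : Tournament V), G.IsFree Tournament.B4 →
      ∀ w : V → ℚ, (∀ v, 0 ≤ w v) →
        ∃ v, G.IsIndep (G.closedOut v : Set V) ∧
          ∀ S : Finset V, G.IsIndep (S : Set V) → ∑ u ∈ S, w u ≤ ∑ u ∈ G.closedOut v, w u) ∧
    -- in a `C4`-free tournament every strong component has size 1 or 3
    (∀ (V : Type*) [Fintype V] (G : Tournament V), G.IsFree Tournament.C4 →
      ∀ v, (G.strongComponent v).ncard = 1 ∨ (G.strongComponent v).ncard = 3) := by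
  exact ⟨fun W _ H hW => StackMachine.solvableInPolyTime hW, Tournament.finite_isFree_K4,
    fun V _ _ G hG w hw => hG.exists_closedOut_optimal hw,
    fun V _ G hG v => hG.ncard_strongComponent v⟩
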